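/- **Setting.** Let $A_i\in\mathbb R^{d\times d}$, $B_i\in\mathbb R^{d\times k}$, $Q_i\in\mathbb R^{d\times d}$, $R_i\in\mathbb R^{k\times k}$ for $i\in\{1,\dots,N\}$, with all $Q_i$ and $R_i$ symmetric positive definite. Let $(\omega(t))_{t\ge 0}$ be a time-homogeneous Markov chain on $\{1,\dots,N\}$ with transition probabilities $p_{ij}$ and initial distribution $\pi$, $\pi_i>0$ for all $i$, and let $x_0$ be a square-integrable random vector in $\mathbb R^d$, independent of the chain, with $\Sigma_0=\mathbb E[x_0x_0^T]\succ0$. For a tuple $K=(K_1,\dots,K_N)$ of matrices in $\mathbb R^{k\times d}$ consider $x_{t+1}=A_{\omega(t)}x_t+B_{\omega(t)}u_t$ with $u_t=-K_{\omega(t)}x_t$, and $$C(K)=\mathbb E\Big[\sum_{t=0}^\infty x_t^TQ_{\omega(t)}x_t+u_t^TR_{\omega(t)}u_t\Big].$$ Let $\mathbb K$ be the set of those $K$ for which the closed loop is mean-square stable, that is, $\mathbb E[x_tx_t^T]\to0$ for every deterministic initial state and every initial mode $\omega(0)$; assume $\mathbb K\neq\emptyset$. For $K\in\mathbb K$ let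 $\mathbf X^K=(\mathbf X^K_1,\dots,\mathbf X^K_N)$ with $\mathbf X^K_i=\sum_{t\ge0}\mathbb E[x_tx_t^T\mathbf 1_{\omega(t)=i}]$. Gradients are taken with respect to $\langle V,S\rangle=\sum_i\operatorname{tr}(V_i^TS_i)$. For a tuple $V$ let $\|V\|_{\max}=\max_i\|V_i\|$ (largest singular value) and $\Lambda_{\min}(V)=\min_i\sigma_{\min}(V_i)$ (smallest singular value). Put $\mathcal E_i(V)=\sum_jp_{ij}V_j$, $\mu=\min_i\pi_i\,\sigma_{\min}(\Sigma_0)$ and, for $\alpha\in\mathbb R$, $$\xi_\alpha=\frac1{\Lambda_{\min}(Q)}\Big(\frac{1+\|B\|_{\max}^2}{\mu}\alpha+\|R\|_{\max}\Big)-1,\qquad L_\alpha=2\Big(\|R\|_{\max}+\big(\|B\|_{\max}^2+2\xi_\alpha\|B\|_{\max}\big)\frac\alpha\mu\Big)\frac{\alpha}{\Lambda_{\min}(Q)}.$$ **Theorem (global convergence of policy gradient).** The coupled Riccati equations $$P_i=Q_i+A_i^T\mathcal E_i(P)A_i-A_i^T\mathcal E_i(P)B_i\big(R_i+B_i^T\mathcal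 E_i(P)B_i\big)^{-1}B_i^T\mathcal E_i(P)A_i\qquad(1\le i\le N)$$ have a unique solution $P=(P_1,\dots,P_N)$ with all $P_i$ positive definite. The gain $K^*_i=(R_i+B_i^T\mathcal E_i(P)B_i)^{-1}B_i^T\mathcal E_i(P)A_i$ lies in $\mathbb K$ and minimizes $C$ over $\mathbb K$, $C(K^*)<\infty$, and the series defining $\mathbf X^{K^*}$ converges. Let $K^0\in\mathbb K$, $\alpha=C(K^0)$ and $L=L_\alpha$. For every step size $0<\eta\le 1/L$ the gradient descent iterates $K^{n+1}=K^n-\eta\nabla C(K^n)$ all stay in $\mathbb K$ (and $C$ is finite and differentiable at each of them), they converge to $K^*$, and for all $n\ge0$ $$C(K^n)-C(K^*)\le\Big(1-\frac{2\mu^2\Lambda_{\min}(R)}{\|\mathbf X^{K^*}\|_{\max}}\,\eta\Big)^n\big(C(K^0)-C(K^*)\big).$$ -/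

import Mathlib

open MeasureTheory ProbabilityTheory Filter Topology
open scoped Matrix ENNReal

noncomputable section

/-- `N`-tuples of real `m × n` matrices. -/
abbrev MatTuple (N m n : ℕ) : Type := Fin N → Matrix (Fin m) (Fin n) ℝ

/-- The maximal singular value, i.e. the operator norm for the Euclidean norms. -/
def specNorm {m n : ℕ} (M : Matrix (Fin m) (Fin n) ℝ) : ℝ :=
  ‖(Matrix.toEuclideanLin M).toContinuousLinearMap‖

/-- The minimal singular value of a square matrix (the singular values are listed in
decreasing order, with indices `0, …, n - 1`). -/
def sigmaMin {n : ℕ} (M : Matrix (Fin n) (Fin n) ℝ) : ℝ :=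
  (Matrix.toEuclideanLin M).singularValues (n - 1)

/-- `‖V‖_max`, the largest spectral norm of a member of the tuple. -/
def maxNorm {N m n : ℕ} (V : MatTuple N m n) : ℝ := ⨆ i, specNorm (V i)

/-- `Λ_min(V)`, the smallest singular value of all members of the tuple. -/
def lambdaMin {N n : ℕ} (V : MatTuple N n n) : ℝ := ⨅ i, sigmaMin (V i)

/-- The matrix `𝔼[x xᵀ]` of second moments of a random vector. -/
def secondMoment {W : Type*} [MeasurableSpace W] {d : ℕ} (Pr : Measure W)
    (x : W → Fin d → ℝ) : Matrix (Fin d) (Fin d) ℝ :=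
  Matrix.of fun a b => ∫ w, x w a * x w b ∂Pr

/-- The data of a Markovian jump linear quadratic control problem with `N` modes, state
dimension `d` and control dimension `k`: system matrices, cost matrices, transition
probabilities and initial distribution of the mode. -/
structure MJLS (N d k : ℕ) where
  A : MatTuple N d d
  B : MatTuple N d k
  Q : MatTuple N d d
  R : MatTuple N k k
  p : Matrix (Fin N) (Fin N) ℝ
  init : Fin N → ℝ

namespace MJLS

variable {N d k : ℕ} (S : MJLS N d k)

/-- The state `x_t` driven by the mode sequence `s` from the initial state `v`, under the
feedback `u_t = -K_{s(t)} x_t`:  `x_{t+1} = A_{s(t)} x_t + B_{s(t)} u_t`. -/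
def state (K : MatTuple N k d) (s : ℕ → Fin N) (v : Fin d → ℝ) : ℕ → Fin d → ℝ
  | 0 => v
  | t + 1 => S.A (s t) *ᵥ state K s v t + S.B (s t) *ᵥ (-(K (s t) *ᵥ state K s v t))

/-- The control `u_t = -K_{s(t)} x_t`. -/
def control (K : MatTuple N k d) (s : ℕ → Fin N) (v : Fin d → ℝ) (t : ℕ) : Fin k → ℝ :=
  -(K (s t) *ᵥ S.state K s v t)

/-- The stage cost `x_tᵀ Q_{s(t)} x_t + u_tᵀ R_{s(t)} u_t`. -/
def stageCost (K : MatTuple N k d) (s : ℕ → Fin N) (v : Fin d → ℝ) (t : ℕ) : ℝ :=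
  S.state K s v t ⬝ᵥ (S.Q (s t) *ᵥ S.state K s v t)
    + S.control K s v t ⬝ᵥ (S.R (s t) *ᵥ S.control K s v t)

/-- `ℰ_i(V) = ∑_j p_{ij} V_j`. -/
def E (V : MatTuple N d d) : MatTuple N d d := fun i => ∑ j, S.p i j • V j

/-- `P` is a positive definite solution of the coupled algebraic Riccati equations. -/
def IsRiccatiSolution (P : MatTuple N d d) : Prop :=
  (∀ i, (P i).PosDef) ∧
  ∀ i, P i = S.Q i + (S.A i)ᵀ * S.E P i * S.A i
    - (S.A i)ᵀ * S.E P i * S.B i * (S.R i + (S.B i)ᵀ * S.E P i * S.B i)⁻¹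
        * (S.B i)ᵀ * S.E P i * S.A i

/-- The feedback gain `(R + Bᵀ ℰ(P) B)⁻¹ Bᵀ ℰ(P) A`. -/
def riccatiGain (P : MatTuple N d d) : MatTuple N k d := fun i =>
  (S.R i + (S.B i)ᵀ * S.E P i * S.B i)⁻¹ * (S.B i)ᵀ * S.E P i * S.A i

section Probability

variable {W : Type*} [MeasurableSpace W] (Pr : Measure W)
  (x0 : W → Fin d → ℝ) (ω : ℕ → W → Fin N)

/-- The random initial state `x0` is square integrable, the mode process `ω` is a
time-homogeneous Markov chain with transition matrix `p` and initial distribution `init`,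
and `x0` is independent of `ω`.  The Markov property is written without division:
`Pr(ω_{t+1} = j, ω_0 = s_0, …, ω_t = s_t) = p_{s_t j} Pr(ω_0 = s_0, …, ω_t = s_t)`. -/
structure IsRealization : Prop where
  measurable_x0 : Measurable x0
  memLp_x0 : MemLp x0 2 Pr
  measurable_mode : ∀ t, Measurable (ω t)
  init_law : ∀ i, Pr.real {w | ω 0 w = i} = S.init i
  markov : ∀ (t : ℕ) (s : ℕ → Fin N) (j : Fin N),
    Pr.real {w | (∀ r ≤ t, ω r w = s r) ∧ ω (t + 1) w = j}
      = S.p (s t) j * Pr.real {w | ∀ r ≤ t, ω r w = s r}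
  indep : IndepFun x0 (fun w t => ω t w) Pr

/-- The set `𝕂` of gains for which the closed loop is mean-square stable: `𝔼[x_t x_tᵀ] → 0`
for every deterministic initial state `v` and every initial mode `i`, the expectation being
that of the chain started at `i`, i.e. conditional on `ω(0) = i`. -/
def stabilizing : Set (MatTuple N k d) :=
  {K | ∀ (v : Fin d → ℝ) (i : Fin N),
    Tendsto (fun t => secondMoment (Pr[|{w | ω 0 w = i}])
      (fun w => S.state K (fun r => ω r w) v t)) atTop (𝓝 0)}

/-- The cost `𝔼[∑_t x_tᵀ Q x_t + u_tᵀ R u_t]`, with values in `[0, ∞]`. -/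
def extCost (K : MatTuple N k d) : ℝ≥0∞ :=
  ∫⁻ w, ∑' t, ENNReal.ofReal (S.stageCost K (fun r => ω r w) (x0 w) t) ∂Pr

/-- The cost `C(K)` as a real number, meaningful where `extCost` is finite. -/
def cost (K : MatTuple N k d) : ℝ := (S.extCost Pr x0 ω K).toReal

/-- The gradient `∇C(K)` for the inner product `⟨V, S⟩ = ∑_i tr(V_iᵀ S_i)`: the `(a, b)` entry
of its `i`-th member is the derivative of `C` in the direction of the `(a, b)` entry of `K_i`. -/
def gradCost (K : MatTuple N k d) : MatTuple N k d := fun i =>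
  Matrix.of fun a b => fderiv ℝ (S.cost Pr x0 ω) K (Pi.single i (Matrix.single a b 1))

/-- `X_i(t) = 𝔼[x_t x_tᵀ 1_{ω(t) = i}]`. -/
def modeCov (K : MatTuple N k d) (t : ℕ) : MatTuple N d d := fun i =>
  secondMoment (Pr.restrict {w | ω t w = i}) (fun w => S.state K (fun r => ω r w) (x0 w) t)

/-- `𝐗^K = ∑_t X(t)`. -/
def sumCov (K : MatTuple N k d) : MatTuple N d d := ∑' t, S.modeCov Pr x0 ω K t

/-- `μ = min_i π_i · σ_min(𝔼[x_0 x_0ᵀ])`. -/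
def mu : ℝ := (⨅ i, S.init i) * sigmaMin (secondMoment Pr x0)

/-- The constant `ξ` at level `α`. -/
def xi (α : ℝ) : ℝ :=
  1 / lambdaMin S.Q * ((1 + maxNorm S.B ^ 2) / S.mu Pr x0 * α + maxNorm S.R) - 1

/-- The smoothness constant `L` of the sublevel set at level `α`:
`2 (‖R‖ + ‖B‖² (1 + 2 ξ / ‖B‖) α / μ) α / Λ_min(Q)`, with `‖B‖² (1 + 2 ξ / ‖B‖)` read as
`‖B‖² + 2 ξ ‖B‖`. -/
def smoothConst (α : ℝ) : ℝ :=
  2 * (maxNorm S.R + (maxNorm S.B ^ 2 + 2 * S.xi Pr x0 α * maxNorm S.B) * (α / S.mu Pr x0))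
    * (α / lambdaMin S.Q)

/-- The gradient descent iterates `K^{n+1} = K^n - η ∇C(K^n)`. -/
def gdIter (η : ℝ) (K0 : MatTuple N k d) : ℕ → MatTuple N k d
  | 0 => K0
  | n + 1 => gdIter η K0 n - η • S.gradCost Pr x0 ω (gdIter η K0 n)

end Probability

end MJLS

end

/-! Randomness enters only through the mode-wise second moments, which evolve linearly: independence
of `x0` and the Markov property give X(t+1) = `forward` X(t) (`IsDriven.secondMoment_restrict`). The
adjoint `backward` for the trace pairing propagates quadratic costs. Both maps preserve positive
semidefinite tuples, and mean-square stability amounts to a P ≥ 0 with Q + `backward` P ≤ P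
(`Stable`). For such K the Neumann series P^K = `value` and X^K = `totalCov` converge, and C(K) =
⟨X₀, P^K⟩.

The engine is an exact difference formula, `Stable.cost_sub_cost`. Put D = K' - K, P' = P^{K'} and
M' = R K' - Bᵀℰ(P')(A - B K'). Then C(K') - C(K) = ⟨X^K, DᵀM' + M'ᵀD - Dᵀ(R + Bᵀℰ(P')B)D⟩. Since X^K
≥ μ, the gradient 2 M X^K vanishes only where the residual M does, that is, where K is the Riccati
gain of P^K. With K' = K* the residual drops out, leaving P* ≤ P^K and quadratic growth of C around
K* (`frobSq_sub_optimal_le`). With base point K* and K' = K, completing the square in D gives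
gradient dominance (`Stable.cost_sub_le_frobSq_costGradient`), the substitute for convexity.
Replacing P' by P on the right costs a term in P' - P, which is at most |D| ξ P
(`Stable.value_sub_le`). Hence C deviates from its linearization by at most (L/2)|D|² for any two
gains of a sublevel set, whether or not the segment between them stays inside
(`Stable.abs_cost_sub_le`).

Sublevel sets are compact, so a minimizer exists; it is critical and yields the Riccati solution. A
continuation argument along the gradient ray keeps each step inside the sublevel set
(`Stable.descent`), so the cost drops by (η/2)|∇C|². Gradient dominance turns this into a
contraction, and quadratic growth into convergence of the gains. -/

noncomputable section

open scoped MatrixOrder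

namespace Matrix

/-! ### The Loewner order on real matrices -/

section LoewnerOrder

variable {m n : Type*} [Fintype m] [Fintype n]

theorem nonneg_iff_dotProduct_mulVec {A : Matrix n n ℝ} :
    0 ≤ A ↔ Aᵀ = A ∧ ∀ v, 0 ≤ v ⬝ᵥ (A *ᵥ v) := by
  rw [nonneg_iff_posSemidef, posSemidef_iff_dotProduct_mulVec, IsHermitian,
    conjTranspose_eq_transpose_of_trivial]
  simp

theorem transpose_eq_of_nonneg {A : Matrix n n ℝ} (hA : 0 ≤ A) : Aᵀ = A :=
  (nonneg_iff_dotProduct_mulVec.1 hA).1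

theorem trace_nonneg_of_nonneg {A : Matrix n n ℝ} (hA : 0 ≤ A) : 0 ≤ A.trace :=
  (nonneg_iff_posSemidef.1 hA).trace_nonneg

theorem transpose_mul_mul_nonneg {A : Matrix n n ℝ} (hA : 0 ≤ A) (C : Matrix n m ℝ) :
    0 ≤ Cᵀ * A * C := by
  have := ((nonneg_iff_posSemidef.1 hA).conjTranspose_mul_mul_same C).nonneg
  rwa [conjTranspose_eq_transpose_of_trivial] at this

theorem mul_mul_transpose_nonneg {A : Matrix n n ℝ} (hA : 0 ≤ A) (C : Matrix m n ℝ) :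
    0 ≤ C * A * Cᵀ := by
  simpa using transpose_mul_mul_nonneg hA Cᵀ

theorem transpose_mul_self_nonneg (C : Matrix n m ℝ) : 0 ≤ Cᵀ * C := by
  have := (posSemidef_conjTranspose_mul_self C).nonneg
  rwa [conjTranspose_eq_transpose_of_trivial] at this

theorem transpose_mul_mul_mono {A B : Matrix n n ℝ} (h : A ≤ B) (C : Matrix n m ℝ) :
    Cᵀ * A * C ≤ Cᵀ * B * C := by
  rw [← sub_nonneg] at h ⊢
  simpa [Matrix.mul_sub, Matrix.sub_mul] using transpose_mul_mul_nonneg h C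

theorem exists_eq_transpose_mul_self {A : Matrix n n ℝ} (hA : 0 ≤ A) :
    ∃ C : Matrix n n ℝ, A = Cᵀ * C := by
  classical
  obtain ⟨C, hC⟩ := CStarAlgebra.nonneg_iff_eq_star_mul_self.mp hA
  exact ⟨C, by rw [hC, star_eq_conjTranspose, conjTranspose_eq_transpose_of_trivial]⟩

theorem trace_mul_nonneg {A B : Matrix n n ℝ} (hA : 0 ≤ A) (hB : 0 ≤ B) :
    0 ≤ (A * B).trace := by
  obtain ⟨C, rfl⟩ := exists_eq_transpose_mul_self hA
  rw [Matrix.mul_assoc, trace_mul_comm]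
  exact trace_nonneg_of_nonneg (mul_mul_transpose_nonneg hB C)

theorem trace_mul_mono_right {A B C : Matrix n n ℝ} (hA : 0 ≤ A) (h : B ≤ C) :
    (A * B).trace ≤ (A * C).trace := by
  have := trace_mul_nonneg hA (sub_nonneg.2 h)
  rw [Matrix.mul_sub, trace_sub] at this
  linarith

theorem dotProduct_mulVec_mono {A B : Matrix n n ℝ} (h : A ≤ B) (v : n → ℝ) :
    v ⬝ᵥ (A *ᵥ v) ≤ v ⬝ᵥ (B *ᵥ v) := by
  have := (nonneg_iff_dotProduct_mulVec.1 (sub_nonneg.2 h)).2 v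
  rw [sub_mulVec, dotProduct_sub] at this
  linarith

/-- Cauchy–Schwarz for the columns of C in A = CᵀC. It reduces entrywise convergence of nonnegative
series to convergence of traces. -/
theorem abs_apply_le_trace {A : Matrix n n ℝ} (hA : 0 ≤ A) (a b : n) : |A a b| ≤ A.trace := by
  obtain ⟨C, rfl⟩ := exists_eq_transpose_mul_self hA
  have htr : (Cᵀ * C).trace = ∑ j, ∑ i, C i j ^ 2 := by
    simp [trace, mul_apply, sq]
  have hsq : ∀ j, ∑ i, C i j ^ 2 ≤ (Cᵀ * C).trace := fun j => by
    rw [htr]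
    exact Finset.single_le_sum (f := fun j => ∑ i, C i j ^ 2)
      (fun j _ => Finset.sum_nonneg fun i _ => sq_nonneg _) (Finset.mem_univ j)
  refine abs_le_of_sq_le_sq ?_ (trace_nonneg_of_nonneg hA)
  calc (Cᵀ * C) a b ^ 2 = (∑ i, C i a * C i b) ^ 2 := by simp [mul_apply]
    _ ≤ (∑ i, C i a ^ 2) * ∑ i, C i b ^ 2 := Finset.sum_mul_sq_le_sq_mul_sq _ _ _
    _ ≤ (Cᵀ * C).trace * (Cᵀ * C).trace :=
        mul_le_mul (hsq a) (hsq b) (Finset.sum_nonneg fun i _ => sq_nonneg _)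
          (trace_nonneg_of_nonneg hA)
    _ = _ := (sq _).symm

theorem nonneg_of_transpose_eq {A : Matrix n n ℝ} (hA : Aᵀ = A)
    (h : ∀ v, 0 ≤ v ⬝ᵥ (A *ᵥ v)) : 0 ≤ A :=
  nonneg_iff_dotProduct_mulVec.2 ⟨hA, h⟩

theorem le_of_dotProduct_mulVec_le {A B : Matrix n n ℝ} (hA : Aᵀ = A) (hB : Bᵀ = B)
    (h : ∀ v, v ⬝ᵥ (A *ᵥ v) ≤ v ⬝ᵥ (B *ᵥ v)) : A ≤ B := by
  rw [← sub_nonneg]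
  refine nonneg_of_transpose_eq (by simp [hA, hB]) fun v => ?_
  rw [sub_mulVec, dotProduct_sub]
  linarith [h v]

theorem transpose_mul_self_mulVec (C : Matrix m n ℝ) (v : n → ℝ) :
    v ⬝ᵥ ((Cᵀ * C) *ᵥ v) = (C *ᵥ v) ⬝ᵥ (C *ᵥ v) := by
  rw [← mulVec_mulVec, dotProduct_mulVec, vecMul_transpose]

theorem le_trace_smul_one [DecidableEq n] {A : Matrix n n ℝ} (hA : 0 ≤ A) :
    A ≤ A.trace • (1 : Matrix n n ℝ) := by
  refine le_of_dotProduct_mulVec_le (transpose_eq_of_nonneg hA) (by simp) fun v => ?_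
  obtain ⟨C, rfl⟩ := exists_eq_transpose_mul_self hA
  have htr : (Cᵀ * C).trace = ∑ i, ∑ j, C i j ^ 2 := by
    rw [Finset.sum_comm]
    simp [trace, mul_apply, sq]
  rw [transpose_mul_self_mulVec, htr, smul_mulVec, one_mulVec, dotProduct_smul, smul_eq_mul,
    Finset.sum_mul]
  refine Finset.sum_le_sum fun i _ => ?_
  calc (C *ᵥ v) i * (C *ᵥ v) i = (∑ j, C i j * v j) ^ 2 := by simp [mulVec, dotProduct, sq]
    _ ≤ (∑ j, C i j ^ 2) * ∑ j, v j ^ 2 := Finset.sum_mul_sq_le_sq_mul_sq _ _ _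
    _ = _ := by simp [dotProduct, sq]

/-- The Young inequality in the semi-inner product given by a positive semidefinite matrix. -/
theorem young_of_nonneg {G : Matrix n n ℝ} (hG : 0 ≤ G) (U V : Matrix n m ℝ) {w : ℝ}
    (hw : 0 < w) : Uᵀ * G * V + Vᵀ * G * U ≤ w • (Uᵀ * G * U) + w⁻¹ • (Vᵀ * G * V) := by
  rw [← sub_nonneg]
  have h := smul_nonneg (inv_nonneg.2 hw.le) (transpose_mul_mul_nonneg hG (w • U - V))
  have e : w⁻¹ • ((w • U - V)ᵀ * G * (w • U - V))
      = w • (Uᵀ * G * U) + w⁻¹ • (Vᵀ * G * V) - (Uᵀ * G * V + Vᵀ * G * U) := by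
    simp only [transpose_sub, transpose_smul, Matrix.sub_mul, Matrix.mul_sub, Matrix.smul_mul,
      Matrix.mul_smul, smul_sub, smul_smul]
    rw [inv_mul_cancel₀ hw.ne', ← mul_assoc, inv_mul_cancel₀ hw.ne']
    simp only [one_mul, one_smul]
    abel
  rwa [e] at h

/-- A two-sided bound `-c ≤ G ≤ c` controls the bilinear form of `G`. -/
theorem young_of_le_of_le [DecidableEq n] {G : Matrix n n ℝ} {c : ℝ} (h₁ : G ≤ c • 1)
    (h₂ : -G ≤ c • 1) (U V : Matrix n m ℝ) {w : ℝ} (hw : 0 < w) :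
    Uᵀ * G * V + Vᵀ * G * U ≤ c • (w • (Uᵀ * U) + w⁻¹ • (Vᵀ * V)) := by
  -- Polarization: the form of G at wU + V minus that at wU - V is 2w times the cross terms, while
  -- the two upper bounds add up to 2c(w²UᵀU + VᵀV).
  have e₁ := transpose_mul_mul_mono h₁ (w • U + V)
  have e₂ := transpose_mul_mul_mono h₂ (w • U - V)
  have e := smul_le_smul_of_nonneg_left (add_le_add e₁ e₂)
    (by positivity : (0 : ℝ) ≤ w⁻¹ * 2⁻¹)
  rw [← sub_nonneg] at e ⊢
  convert e using 1
  simp only [transpose_sub, transpose_add, transpose_smul, Matrix.sub_mul, Matrix.mul_sub,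
    Matrix.smul_mul, Matrix.add_mul, Matrix.mul_add,
    Matrix.mul_smul, smul_sub, smul_add, smul_smul, Matrix.mul_one, Matrix.mul_neg,
    Matrix.neg_mul, smul_neg]
  have hw' := hw.ne'
  ext i j
  simp only [add_apply, sub_apply, smul_apply, neg_apply, smul_eq_mul]
  field_simp
  ring

end LoewnerOrder

section Topology

variable {n : Type*} [Fintype n]

theorem isClosed_setOf_nonneg : IsClosed {A : Matrix n n ℝ | 0 ≤ A} := by
  simp only [nonneg_iff_dotProduct_mulVec, Set.ofPred_and, Set.ofPred_forall]
  refine IsClosed.inter (isClosed_eq (by fun_prop) continuous_id) (isClosed_iInter fun v => ?_)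
  exact isClosed_le continuous_const (by fun_prop)

/-- Lets Loewner inequalities pass to limits and to infinite sums. -/
instance orderClosedTopology : OrderClosedTopology (Matrix n n ℝ) where
  isClosed_le' := by
    have : {p : Matrix n n ℝ × Matrix n n ℝ | p.1 ≤ p.2}
        = (fun p : Matrix n n ℝ × Matrix n n ℝ => p.2 - p.1) ⁻¹' {A | 0 ≤ A} := by
      ext p; simp
    rw [this]
    exact isClosed_setOf_nonneg.preimage (by fun_prop)

end Topology

/-! ### Extreme singular values as Loewner bounds -/

section SingularValues

variable {m n : ℕ}

theorem sigmaMin_nonneg (M : Matrix (Fin n) (Fin n) ℝ) : 0 ≤ sigmaMin M :=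
  LinearMap.singularValues_nonneg _ _

theorem sigmaMin_of_size_zero (M : Matrix (Fin 0) (Fin 0) ℝ) : sigmaMin M = 0 :=
  LinearMap.singularValues_of_finrank_le _ (by simp)

theorem sigmaMin_pos (hn : 0 < n) {M : Matrix (Fin n) (Fin n) ℝ} (hM : M.PosDef) :
    0 < sigmaMin M := by
  refine (LinearMap.injective_iff_forall_lt_finrank_singularValues_pos _).1 ?_ _
    (by simpa using hn)
  intro x y hxy
  have h : M *ᵥ x.ofLp = M *ᵥ y.ofLp := by
    have := congrArg WithLp.ofLp hxy
    simpa using this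
  exact WithLp.ofLp_injective 2 (mulVec_injective_iff_isUnit.2 hM.isUnit h)

/-- For symmetric M, the number c² is an eigenvalue of MᵀM, so c itself is a singular value, and the
one of index n - 1 is the smallest. -/
theorem sigmaMin_le_of_mulVec_eq_smul (hn : 0 < n) {M : Matrix (Fin n) (Fin n) ℝ}
    (hM : M.IsHermitian) {v : Fin n → ℝ} (hv : v ≠ 0) {c : ℝ} (hc : 0 ≤ c)
    (h : M *ᵥ v = c • v) : sigmaMin M ≤ c := by
  set T := Matrix.toEuclideanLin M with hT
  have hsymm : T.IsSymmetric := isSymmetric_toEuclideanLin_iff.2 hM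
  have hTv : T (WithLp.toLp 2 v) = c • WithLp.toLp 2 v := by
    rw [hT, toLpLin_toLp, toLin'_apply, h, WithLp.toLp_smul]
  have heig : Module.End.HasEigenvalue (LinearMap.adjoint T ∘ₗ T) (c ^ 2) := by
    refine Module.End.hasEigenvalue_of_hasEigenvector (x := WithLp.toLp 2 v)
      ⟨Module.End.mem_eigenspace_iff.2 ?_, by simpa using hv⟩
    rw [LinearMap.IsSymmetric.adjoint_eq hsymm, LinearMap.comp_apply, hTv, map_smul, hTv,
      smul_smul, sq]
  obtain ⟨i, hi⟩ := T.isSymmetric_adjoint_comp_self.exists_eigenvalues_eq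
    (n := n) (by simp) heig
  have hsq : T.singularValues i ^ 2 = c ^ 2 := by
    rw [T.sq_singularValues_fin (by simp) i]
    exact_mod_cast hi
  have hval : T.singularValues i = c :=
    (sq_eq_sq₀ (T.singularValues_nonneg _) hc).1 hsq
  rw [← hval]
  exact T.singularValues_antitone (by omega)

theorem sigmaMin_smul_one_le {M : Matrix (Fin n) (Fin n) ℝ} (hM : M.PosDef) :
    sigmaMin M • (1 : Matrix (Fin n) (Fin n) ℝ) ≤ M := by
  rcases Nat.eq_zero_or_pos n with rfl | hn
  · exact le_of_eq (Subsingleton.elim _ _)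
  have hH : (M - sigmaMin M • (1 : Matrix (Fin n) (Fin n) ℝ)).IsHermitian := by
    rw [IsHermitian, conjTranspose_eq_transpose_of_trivial, transpose_sub, transpose_smul,
      transpose_one, ← conjTranspose_eq_transpose_of_trivial M, hM.1]
  -- An eigenvalue of the shifted matrix, plus the shift, is an eigenvalue of M and so at least the
  -- shift.
  rw [le_iff, hH.posSemidef_iff_eigenvalues_nonneg]
  intro i
  set v := (hH.eigenvectorBasis i).ofLp
  have hv : v ≠ 0 := by
    have := hH.eigenvectorBasis.orthonormal.ne_zero i
    simpa [v] using this
  have hev : M *ᵥ v = (hH.eigenvalues i + sigmaMin M) • v := by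
    have := hH.mulVec_eigenvectorBasis i
    rw [sub_mulVec, smul_mulVec, one_mulVec, sub_eq_iff_eq_add] at this
    rw [add_smul]
    exact this
  have hpos : 0 ≤ hH.eigenvalues i + sigmaMin M := by
    have h := hM.dotProduct_mulVec_pos hv
    rw [hev, dotProduct_smul, smul_eq_mul] at h
    have h' : 0 < star v ⬝ᵥ v := dotProduct_star_self_pos_iff.2 hv
    exact (pos_of_mul_pos_left h h'.le).le
  have := sigmaMin_le_of_mulVec_eq_smul hn hM.1 hv hpos hev
  simp only [Pi.zero_apply]
  linarith

theorem specNorm_nonneg (M : Matrix (Fin m) (Fin n) ℝ) : 0 ≤ specNorm M := norm_nonneg _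

theorem mulVec_dotProduct_self_le (M : Matrix (Fin m) (Fin n) ℝ) (v : Fin n → ℝ) :
    (M *ᵥ v) ⬝ᵥ (M *ᵥ v) ≤ specNorm M ^ 2 * (v ⬝ᵥ v) := by
  have h := (Matrix.toEuclideanLin M).toContinuousLinearMap.le_opNorm (WithLp.toLp 2 v)
  have h2 := pow_le_pow_left₀ (norm_nonneg _) h 2
  rw [mul_pow, EuclideanSpace.norm_sq_eq, EuclideanSpace.norm_sq_eq] at h2
  simpa [dotProduct, ← sq, specNorm] using h2

theorem transpose_mul_self_le_specNorm (M : Matrix (Fin m) (Fin n) ℝ) :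
    Mᵀ * M ≤ specNorm M ^ 2 • (1 : Matrix (Fin n) (Fin n) ℝ) := by
  refine le_of_dotProduct_mulVec_le (by simp) (by simp) fun v => ?_
  rw [transpose_mul_self_mulVec, smul_mulVec, one_mulVec, dotProduct_smul, smul_eq_mul]
  exact mulVec_dotProduct_self_le M v

theorem le_specNorm_smul_one {M : Matrix (Fin n) (Fin n) ℝ} (hM : Mᵀ = M) :
    M ≤ specNorm M • (1 : Matrix (Fin n) (Fin n) ℝ) := by
  refine le_of_dotProduct_mulVec_le hM (by simp) fun v => ?_
  rw [smul_mulVec, one_mulVec, dotProduct_smul, smul_eq_mul]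
  have h1 : (v ⬝ᵥ (M *ᵥ v)) ^ 2 ≤ (v ⬝ᵥ v) * ((M *ᵥ v) ⬝ᵥ (M *ᵥ v)) := by
    simpa [dotProduct, ← sq] using Finset.sum_mul_sq_le_sq_mul_sq Finset.univ v (M *ᵥ v)
  have h2 := mulVec_dotProduct_self_le M v
  have h0 : 0 ≤ v ⬝ᵥ v := by simpa using dotProduct_star_self_nonneg v
  refine le_of_abs_le (abs_le_of_sq_le_sq ?_ (mul_nonneg (specNorm_nonneg M) h0))
  calc _ ≤ _ := h1
    _ ≤ (v ⬝ᵥ v) * (specNorm M ^ 2 * (v ⬝ᵥ v)) := mul_le_mul_of_nonneg_left h2 h0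
    _ = _ := by ring

theorem specNorm_of_size_zero (M : Matrix (Fin m) (Fin 0) ℝ) : specNorm M = 0 := by
  have : (Matrix.toEuclideanLin M).toContinuousLinearMap = 0 := by
    ext x; simp [Subsingleton.elim x 0]
  rw [specNorm, this, norm_zero]

end SingularValues

end Matrix

open Matrix

section Tuples

variable {N m n : ℕ}

theorem specNorm_le_maxNorm (V : MatTuple N m n) (i : Fin N) : specNorm (V i) ≤ maxNorm V :=
  le_ciSup (f := fun i => specNorm (V i)) (Set.finite_range _).bddAbove i

theorem maxNorm_nonneg (V : MatTuple N m n) : 0 ≤ maxNorm V :=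
  Real.iSup_nonneg fun _ => norm_nonneg _

theorem le_maxNorm_smul_one {V : MatTuple N n n} (hV : ∀ i, (V i)ᵀ = V i) (i : Fin N) :
    V i ≤ maxNorm V • (1 : Matrix (Fin n) (Fin n) ℝ) :=
  (le_specNorm_smul_one (hV i)).trans
    (smul_le_smul_of_nonneg_right (specNorm_le_maxNorm V i)
      (PosSemidef.one.nonneg))

theorem transpose_mul_self_le_maxNorm (V : MatTuple N m n) (i : Fin N) :
    (V i)ᵀ * V i ≤ maxNorm V ^ 2 • (1 : Matrix (Fin n) (Fin n) ℝ) :=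
  (transpose_mul_self_le_specNorm (V i)).trans
    (smul_le_smul_of_nonneg_right
      (pow_le_pow_left₀ (specNorm_nonneg _) (specNorm_le_maxNorm V i) 2) (PosSemidef.one.nonneg))

theorem lambdaMin_smul_one_le {V : MatTuple N n n} (hV : ∀ i, (V i).PosDef) (i : Fin N) :
    lambdaMin V • (1 : Matrix (Fin n) (Fin n) ℝ) ≤ V i :=
  (smul_le_smul_of_nonneg_right (ciInf_le (Set.finite_range _).bddBelow i)
    (PosSemidef.one.nonneg)).trans (sigmaMin_smul_one_le (hV i))

theorem ciInf_pos_of_forall_pos [Nonempty (Fin N)] {f : Fin N → ℝ} (hf : ∀ i, 0 < f i) :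
    0 < ⨅ i, f i := by
  obtain ⟨i, hi⟩ := exists_eq_ciInf_of_finite (f := f)
  exact hi ▸ hf i

theorem lambdaMin_pos [Nonempty (Fin N)] (hn : 0 < n) {V : MatTuple N n n}
    (hV : ∀ i, (V i).PosDef) : 0 < lambdaMin V :=
  ciInf_pos_of_forall_pos fun i => sigmaMin_pos hn (hV i)

/-- In dimension zero `lambdaMin` is 0, so the positive constant is supplied separately; the
stability theory then needs no case distinction. -/
theorem exists_pos_smul_one_le [Nonempty (Fin N)] {V : MatTuple N n n}
    (hV : ∀ i, (V i).PosDef) :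
    ∃ c : ℝ, 0 < c ∧ ∀ i, c • (1 : Matrix (Fin n) (Fin n) ℝ) ≤ V i := by
  rcases Nat.eq_zero_or_pos n with rfl | hn
  · exact ⟨1, one_pos, fun i => le_of_eq (Subsingleton.elim _ _)⟩
  · exact ⟨_, lambdaMin_pos hn hV, lambdaMin_smul_one_le hV⟩

end Tuples

/-! ### The trace pairing and Neumann series of monotone maps -/

section Pairing

variable {N d : ℕ}

/-- The trace pairing `∑ i, tr (X i * Y i)` on tuples of square matrices. -/
def pairing : MatTuple N d d →ₗ[ℝ] MatTuple N d d →ₗ[ℝ] ℝ :=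
  LinearMap.mk₂ ℝ (fun X Y => ∑ i, (X i * Y i).trace)
    (fun X X' Y => by simp [Matrix.add_mul, Finset.sum_add_distrib])
    (fun c X Y => by simp [Finset.mul_sum])
    (fun X Y Y' => by simp [Matrix.mul_add, Finset.sum_add_distrib])
    (fun c X Y => by simp [Finset.mul_sum])

theorem pairing_apply (X Y : MatTuple N d d) : pairing X Y = ∑ i, (X i * Y i).trace := rfl

theorem pairing_one (X : MatTuple N d d) : pairing X 1 = ∑ i, (X i).trace := by
  simp [pairing_apply]

theorem pairing_comm (X Y : MatTuple N d d) : pairing X Y = pairing Y X := by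
  rw [pairing_apply, pairing_apply]
  exact Finset.sum_congr rfl fun i _ => trace_mul_comm _ _

theorem pairing_nonneg {X Y : MatTuple N d d} (hX : 0 ≤ X) (hY : 0 ≤ Y) : 0 ≤ pairing X Y := by
  rw [pairing_apply]
  exact Finset.sum_nonneg fun i _ => trace_mul_nonneg (hX i) (hY i)

theorem pairing_mono_right {X Y Z : MatTuple N d d} (hX : 0 ≤ X) (h : Y ≤ Z) :
    pairing X Y ≤ pairing X Z := by
  rw [← sub_nonneg, ← map_sub]
  exact pairing_nonneg hX (sub_nonneg.2 h)

theorem pairing_mono_left {X Y Z : MatTuple N d d} (hX : 0 ≤ X) (h : Y ≤ Z) :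
    pairing Y X ≤ pairing Z X := by
  rw [pairing_comm Y, pairing_comm Z]
  exact pairing_mono_right hX h

theorem tuple_one_nonneg : (0 : MatTuple N d d) ≤ 1 := fun _ => PosSemidef.one.nonneg

theorem trace_le_pairing_one {Y : MatTuple N d d} (hY : 0 ≤ Y) (i : Fin N) :
    (Y i).trace ≤ pairing Y 1 := by
  rw [pairing_one]
  exact Finset.single_le_sum (f := fun i => (Y i).trace)
    (fun j _ => trace_nonneg_of_nonneg (hY j)) (Finset.mem_univ i)

theorem abs_apply_le_pairing_one {Y : MatTuple N d d} (hY : 0 ≤ Y) (i : Fin N) (a b : Fin d) :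
    |Y i a b| ≤ pairing Y 1 :=
  (abs_apply_le_trace (hY i) a b).trans (trace_le_pairing_one hY i)

theorem le_pairing_one_smul_one {Y : MatTuple N d d} (hY : 0 ≤ Y) :
    Y ≤ pairing Y 1 • (1 : MatTuple N d d) := fun i =>
  (le_trace_smul_one (hY i)).trans
    (smul_le_smul_of_nonneg_right (trace_le_pairing_one hY i) PosSemidef.one.nonneg)

/-- Makes all uniformly positive weights interchangeable in Lyapunov inequalities, up to scaling. -/
theorem le_smul_of_smul_one_le {Y Z : MatTuple N d d} (hY : 0 ≤ Y) {c : ℝ} (hc : 0 < c)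
    (hZ : c • (1 : MatTuple N d d) ≤ Z) : Y ≤ (pairing Y 1 / c) • Z := by
  refine (le_pairing_one_smul_one hY).trans ?_
  have h := smul_le_smul_of_nonneg_left hZ
    (div_nonneg (pairing_nonneg hY tuple_one_nonneg) hc.le)
  rwa [smul_smul, div_mul_cancel₀ _ hc.ne'] at h

theorem summable_of_sum_pairing_one_le {Y : ℕ → MatTuple N d d} (hY : ∀ t, 0 ≤ Y t) {c : ℝ}
    (h : ∀ n, ∑ t ∈ Finset.range n, pairing (Y t) 1 ≤ c) : Summable Y := by
  have hs : Summable fun t => pairing (Y t) 1 :=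
    summable_of_sum_range_le (fun t => pairing_nonneg (hY t) tuple_one_nonneg) h
  exact Pi.summable.2 fun i => Pi.summable.2 fun a => Pi.summable.2 fun b =>
    Summable.of_norm_bounded hs fun t => abs_apply_le_pairing_one (hY t) i a b

theorem pairing_right_continuous (X : MatTuple N d d) : Continuous (pairing X) :=
  LinearMap.continuous_of_finiteDimensional _

theorem tsum_pow_apply_eq_add (T : MatTuple N d d →ₗ[ℝ] MatTuple N d d) {Y : MatTuple N d d}
    (h : Summable fun t => (T ^ t) Y) : ∑' t, (T ^ t) Y = Y + T (∑' t, (T ^ t) Y) := by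
  have hT : Continuous T := LinearMap.continuous_of_finiteDimensional T
  rw [h.map_tsum T hT, h.tsum_eq_zero_add]
  simp [pow_succ']

/-- A supersolution Z bounds every partial Neumann sum: if the sum is at most Z, then Y plus T of
the sum is at most Y + T Z ≤ Z. -/
theorem sum_pow_apply_le {T : MatTuple N d d →ₗ[ℝ] MatTuple N d d} (hT : Monotone T)
    {Y Z : MatTuple N d d} (hZ : 0 ≤ Z) (h : Y + T Z ≤ Z) (n : ℕ) :
    ∑ t ∈ Finset.range n, (T ^ t) Y ≤ Z := by
  induction n with
  | zero => simpa using hZ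
  | succ n ih =>
    rw [Finset.sum_range_succ']
    simp only [pow_zero, Module.End.one_apply, pow_succ', Module.End.mul_apply]
    rw [← map_sum, add_comm]
    exact (add_le_add le_rfl (hT ih)).trans h

end Pairing

/-! ### Moment and cost operators, stability, value function -/

namespace MJLS

variable {N d k : ℕ} (S : MJLS N d k)

/-- The standing assumptions: a stochastic transition matrix and positive definite weights. -/
structure IsRegular : Prop where
  nonempty : Nonempty (Fin N)
  p_nonneg : ∀ i j, 0 ≤ S.p i j
  p_sum : ∀ i, ∑ j, S.p i j = 1
  posDef_Q : ∀ i, (S.Q i).PosDef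
  posDef_R : ∀ i, (S.R i).PosDef

/-- The closed-loop matrices `A i - B i * K i`. -/
def closedLoop (K : MatTuple N k d) : MatTuple N d d := fun i => S.A i - S.B i * K i

/-- The operator propagating the mode-wise second moments by one step. -/
def forward (K : MatTuple N k d) : MatTuple N d d →ₗ[ℝ] MatTuple N d d where
  toFun X j := ∑ i, S.p i j • (S.closedLoop K i * X i * (S.closedLoop K i)ᵀ)
  map_add' X Y := by
    ext1 j
    simp [Matrix.mul_add, Matrix.add_mul, Finset.sum_add_distrib]
  map_smul' c X := by
    ext1 j
    simp [Finset.smul_sum, smul_comm c]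

theorem E_add (V V' : MatTuple N d d) : S.E (V + V') = S.E V + S.E V' := by
  ext1 i; simp [E, Finset.sum_add_distrib]

theorem E_smul (c : ℝ) (V : MatTuple N d d) : S.E (c • V) = c • S.E V := by
  ext1 i; simp [E, Finset.smul_sum, smul_comm c]

theorem E_sub (V V' : MatTuple N d d) : S.E (V - V') = S.E V - S.E V' := by
  ext1 i; simp [E, smul_sub, Finset.sum_sub_distrib]

/-- The adjoint of `forward`, propagating quadratic cost-to-go functions by one step. -/
def backward (K : MatTuple N k d) : MatTuple N d d →ₗ[ℝ] MatTuple N d d where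
  toFun V i := (S.closedLoop K i)ᵀ * S.E V i * S.closedLoop K i
  map_add' V V' := by
    ext1 i
    simp [E_add, Matrix.mul_add, Matrix.add_mul]
  map_smul' c V := by
    ext1 i
    simp [E_smul]

theorem backward_apply (K : MatTuple N k d) (V : MatTuple N d d) (i : Fin N) :
    S.backward K V i = (S.closedLoop K i)ᵀ * S.E V i * S.closedLoop K i := rfl

theorem forward_apply (K : MatTuple N k d) (X : MatTuple N d d) (j : Fin N) :
    S.forward K X j = ∑ i, S.p i j • (S.closedLoop K i * X i * (S.closedLoop K i)ᵀ) := rfl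

/-- The quadratic form `Q i + (K i)ᵀ R i K i` of the stage cost under the feedback `K`. -/
def runningCost (K : MatTuple N k d) : MatTuple N d d := fun i =>
  S.Q i + (K i)ᵀ * S.R i * K i

/-- Cyclicity of the trace, after exchanging the sums over the old and the new mode. -/
theorem pairing_forward (K : MatTuple N k d) (X V : MatTuple N d d) :
    pairing (S.forward K X) V = pairing X (S.backward K V) := by
  simp only [pairing_apply, forward_apply, backward_apply, E, Finset.sum_mul, trace_sum,
    Finset.mul_sum, Matrix.smul_mul, Matrix.mul_smul, trace_smul]
  rw [Finset.sum_comm]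
  refine Finset.sum_congr rfl fun i _ => Finset.sum_congr rfl fun j _ => ?_
  congr 1
  rw [Matrix.mul_assoc (S.closedLoop K i * X i), Matrix.mul_assoc (S.closedLoop K i),
    trace_mul_comm]
  simp only [Matrix.mul_assoc]

theorem pairing_forward_pow (K : MatTuple N k d) (t : ℕ) (X V : MatTuple N d d) :
    pairing ((S.forward K ^ t) X) V = pairing X ((S.backward K ^ t) V) := by
  induction t generalizing X with
  | zero => simp
  | succ t ih =>
    rw [pow_succ, Module.End.mul_apply, ih, pairing_forward, pow_succ', Module.End.mul_apply]

variable {S}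

namespace IsRegular

variable (h : S.IsRegular)
include h

theorem Q_nonneg : 0 ≤ S.Q := fun i => (h.posDef_Q i).posSemidef.nonneg

theorem R_nonneg : 0 ≤ S.R := fun i => (h.posDef_R i).posSemidef.nonneg

theorem exists_smul_one_le_Q : ∃ q : ℝ, 0 < q ∧ q • (1 : MatTuple N d d) ≤ S.Q := by
  have := h.nonempty
  exact exists_pos_smul_one_le h.posDef_Q

theorem exists_smul_one_le_R : ∃ r : ℝ, 0 < r ∧ r • (1 : MatTuple N k k) ≤ S.R := by
  have := h.nonempty
  exact exists_pos_smul_one_le h.posDef_R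

theorem E_nonneg {V : MatTuple N d d} (hV : 0 ≤ V) : 0 ≤ S.E V := fun i =>
  Finset.sum_nonneg fun j _ => smul_nonneg (h.p_nonneg i j) (hV j)

theorem E_mono : Monotone S.E := fun V V' hV => by
  rw [← sub_nonneg] at hV ⊢
  rw [← E_sub]
  exact h.E_nonneg hV

theorem E_one : S.E 1 = 1 := by
  ext1 i
  simp [E, ← Finset.sum_smul, h.p_sum i]

theorem E_le_smul_one {V : MatTuple N d d} {c : ℝ} (hV : V ≤ c • 1) : S.E V ≤ c • 1 := by
  have := h.E_mono hV
  rwa [E_smul, h.E_one] at this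

theorem backward_mono (K : MatTuple N k d) : Monotone (S.backward K) := fun _ _ hV i =>
  transpose_mul_mul_mono (h.E_mono hV i) _

theorem backward_nonneg (K : MatTuple N k d) {V : MatTuple N d d} (hV : 0 ≤ V) :
    0 ≤ S.backward K V := by
  simpa using h.backward_mono K hV

theorem forward_nonneg (K : MatTuple N k d) {X : MatTuple N d d} (hX : 0 ≤ X) :
    0 ≤ S.forward K X := fun j => by
  rw [forward_apply]
  exact Finset.sum_nonneg fun i _ => smul_nonneg (h.p_nonneg i j)
    (mul_mul_transpose_nonneg (hX i) (S.closedLoop K i))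

theorem backward_pow_nonneg (K : MatTuple N k d) {V : MatTuple N d d} (hV : 0 ≤ V) (t : ℕ) :
    0 ≤ (S.backward K ^ t) V := by
  induction t with
  | zero => simpa using hV
  | succ t ih =>
    rw [pow_succ', Module.End.mul_apply]
    exact h.backward_nonneg K ih

theorem forward_pow_nonneg (K : MatTuple N k d) {X : MatTuple N d d} (hX : 0 ≤ X) (t : ℕ) :
    0 ≤ (S.forward K ^ t) X := by
  induction t with
  | zero => simpa using hX
  | succ t ih =>
    rw [pow_succ', Module.End.mul_apply]
    exact h.forward_nonneg K ih

theorem Q_le_runningCost (K : MatTuple N k d) : S.Q ≤ S.runningCost K := fun i =>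
  le_add_of_nonneg_right (transpose_mul_mul_nonneg (h.R_nonneg i) _)

theorem runningCost_nonneg (K : MatTuple N k d) : 0 ≤ S.runningCost K :=
  h.Q_nonneg.trans (h.Q_le_runningCost K)

end IsRegular

variable (S)

/-- Existence of a quadratic Lyapunov function for the closed loop. -/
def Stable (K : MatTuple N k d) : Prop :=
  ∃ P : MatTuple N d d, 0 ≤ P ∧ S.Q + S.backward K P ≤ P

/-- The cost-to-go `∑ₜ (backward K)^t (Q + Kᵀ R K)`. -/
def value (K : MatTuple N k d) : MatTuple N d d :=
  ∑' t, (S.backward K ^ t) (S.runningCost K)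

/-- The accumulated mode-wise second moments `∑ₜ (forward K)^t X₀`. -/
def totalCov (X₀ : MatTuple N d d) (K : MatTuple N k d) : MatTuple N d d :=
  ∑' t, (S.forward K ^ t) X₀

variable {S}

theorem Stable.of_le (h : S.IsRegular) {K : MatTuple N k d} {P Y : MatTuple N d d} (hP : 0 ≤ P)
    {c : ℝ} (hc : 0 < c) (hY : c • 1 ≤ Y) (hle : Y + S.backward K P ≤ P) : S.Stable K := by
  have hQ := le_smul_of_smul_one_le h.Q_nonneg hc hY
  have hn := div_nonneg (pairing_nonneg h.Q_nonneg tuple_one_nonneg) hc.le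
  refine ⟨(pairing S.Q 1 / c) • P, smul_nonneg hn hP, ?_⟩
  rw [map_smul]
  have := smul_le_smul_of_nonneg_left hle hn
  rw [smul_add] at this
  exact (add_le_add hQ le_rfl).trans this

namespace Stable

variable (h : S.IsRegular) {K : MatTuple N k d} (hK : S.Stable K)
include h hK

/-- Any Y is dominated by a multiple of Q, so a multiple of the Lyapunov function is a supersolution
for Y and bounds the partial sums. -/
theorem summable_backward {Y : MatTuple N d d} (hY : 0 ≤ Y) :
    Summable fun t => (S.backward K ^ t) Y := by
  obtain ⟨P, hP, hle⟩ := hK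
  obtain ⟨q, hq, hqQ⟩ := h.exists_smul_one_le_Q
  have hYQ := le_smul_of_smul_one_le hY hq hqQ
  set c := pairing Y 1 / q
  have hc : 0 ≤ c := div_nonneg (pairing_nonneg hY tuple_one_nonneg) hq.le
  have hle' : Y + S.backward K (c • P) ≤ c • P := by
    rw [map_smul]
    have := smul_le_smul_of_nonneg_left hle hc
    rw [smul_add] at this
    exact (add_le_add hYQ le_rfl).trans this
  refine summable_of_sum_pairing_one_le (c := pairing (c • P) 1)
    (h.backward_pow_nonneg K hY) fun n => ?_
  have := pairing_mono_left tuple_one_nonneg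
    (sum_pow_apply_le (h.backward_mono K) (smul_nonneg hc hP) hle' n)
  rwa [map_sum, LinearMap.sum_apply] at this

theorem tendsto_backward {Y : MatTuple N d d} (hY : 0 ≤ Y) :
    Tendsto (fun t => (S.backward K ^ t) Y) atTop (𝓝 0) :=
  (hK.summable_backward h hY).tendsto_atTop_zero

/-- By duality the total mass of the forward iterates is X paired with the backward iterates of 1,
which are summable. -/
theorem summable_forward {X : MatTuple N d d} (hX : 0 ≤ X) :
    Summable fun t => (S.forward K ^ t) X := by
  have hs := hK.summable_backward h tuple_one_nonneg
  refine summable_of_sum_pairing_one_le (c := pairing X (∑' t, (S.backward K ^ t) 1))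
    (h.forward_pow_nonneg K hX) fun n => ?_
  simp only [pairing_forward_pow]
  rw [← map_sum]
  exact pairing_mono_right hX
    (hs.sum_le_tsum _ fun t _ => h.backward_pow_nonneg K tuple_one_nonneg t)

theorem value_eq : S.value K = S.runningCost K + S.backward K (S.value K) :=
  tsum_pow_apply_eq_add _ (hK.summable_backward h (h.runningCost_nonneg K))

theorem totalCov_eq {X₀ : MatTuple N d d} (hX : 0 ≤ X₀) :
    S.totalCov X₀ K = X₀ + S.forward K (S.totalCov X₀ K) :=
  tsum_pow_apply_eq_add _ (hK.summable_forward h hX)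

/-- Comparison principle: iterating the hypothesis keeps all `backward` powers of V - U below V - U,
and these powers tend to 0 by stability. -/
theorem le_of_sub_le {U V : MatTuple N d d} (hU : 0 ≤ U) (hV : 0 ≤ V)
    (hle : S.backward K (V - U) ≤ V - U) : U ≤ V := by
  have hpow : ∀ t, (S.backward K ^ t) (V - U) ≤ V - U := fun t => by
    induction t with
    | zero => simp
    | succ t ih =>
      rw [pow_succ', Module.End.mul_apply]
      exact (h.backward_mono K ih).trans hle
  have hlim : Tendsto (fun t => (S.backward K ^ t) (V - U)) atTop (𝓝 0) := by
    simp only [map_sub]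
    simpa using (hK.tendsto_backward h hV).sub (hK.tendsto_backward h hU)
  exact sub_nonneg.1 (le_of_tendsto' hlim hpow)

omit hK in
theorem value_nonneg (K : MatTuple N k d) : 0 ≤ S.value K :=
  tsum_nonneg fun t => h.backward_pow_nonneg K (h.runningCost_nonneg K) t

omit hK in
theorem totalCov_nonneg {X₀ : MatTuple N d d} (hX : 0 ≤ X₀) (K : MatTuple N k d) :
    0 ≤ S.totalCov X₀ K :=
  tsum_nonneg fun t => h.forward_pow_nonneg K hX t

theorem runningCost_le_value : S.runningCost K ≤ S.value K := by
  conv_rhs => rw [hK.value_eq h]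
  exact le_add_of_nonneg_right (h.backward_nonneg K (value_nonneg h K))

theorem Q_le_value : S.Q ≤ S.value K :=
  (h.Q_le_runningCost K).trans (hK.runningCost_le_value h)

theorem le_totalCov {X₀ : MatTuple N d d} (hX : 0 ≤ X₀) : X₀ ≤ S.totalCov X₀ K := by
  conv_rhs => rw [hK.totalCov_eq h hX]
  exact le_add_of_nonneg_right (h.forward_nonneg K (totalCov_nonneg h hX K))

/-- The fixed-point equation of X^K, read through the adjoint. It converts a Lyapunov equation for Z
into a formula for ⟨X₀, Z⟩. -/
theorem pairing_totalCov {X₀ : MatTuple N d d} (hX : 0 ≤ X₀) (Z : MatTuple N d d) :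
    pairing (S.totalCov X₀ K) (Z - S.backward K Z) = pairing X₀ Z := by
  rw [map_sub, ← pairing_forward, ← LinearMap.sub_apply, ← map_sub]
  nth_rw 1 [hK.totalCov_eq h hX]
  rw [add_sub_cancel_right]

theorem pairing_value {X₀ : MatTuple N d d} (hX : 0 ≤ X₀) :
    pairing X₀ (S.value K) = pairing (S.totalCov X₀ K) (S.runningCost K) := by
  rw [← hK.pairing_totalCov h hX]
  congr 1
  nth_rw 1 [hK.value_eq h]
  rw [add_sub_cancel_right]

theorem eq_value {P : MatTuple N d d} (hP : 0 ≤ P)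
    (heq : P = S.runningCost K + S.backward K P) : P = S.value K := by
  have e : S.backward K (P - S.value K) = P - S.value K := by
    conv_rhs => rw [heq, hK.value_eq h]
    rw [map_sub]; abel
  refine le_antisymm ?_ ?_
  · refine hK.le_of_sub_le h hP (value_nonneg h K) (le_of_eq ?_)
    rw [← neg_sub, map_neg, e]
  · exact hK.le_of_sub_le h (value_nonneg h K) hP e.le

/-- The cost-to-go is the least nonnegative supersolution of its Bellman equation. -/
theorem value_le {P : MatTuple N d d} (hP : 0 ≤ P)
    (hle : S.runningCost K + S.backward K P ≤ P) : S.value K ≤ P := by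
  refine hK.le_of_sub_le h (value_nonneg h K) hP ?_
  nth_rw 2 [hK.value_eq h]
  rw [map_sub, sub_le_sub_iff, ← add_assoc, add_comm (S.backward K P)]
  exact add_le_add hle le_rfl

end Stable

theorem Stable.of_runningCost_le (h : S.IsRegular) {K : MatTuple N k d} {P : MatTuple N d d}
    (hP : 0 ≤ P) (hle : S.runningCost K + S.backward K P ≤ P) : S.Stable K :=
  ⟨P, hP, (add_le_add (h.Q_le_runningCost K) le_rfl).trans hle⟩

/-- Bounded partial costs from a nondegenerate initial distribution force stability. -/
theorem Stable.of_sum_le (h : S.IsRegular) {X₀ : MatTuple N d d} {m : ℝ} (hm : 0 < m)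
    (hX : m • 1 ≤ X₀) {K : MatTuple N k d} {α : ℝ}
    (hα : ∀ n, ∑ t ∈ Finset.range n, pairing ((S.forward K ^ t) X₀) (S.runningCost K) ≤ α) :
    S.Stable K ∧ pairing X₀ (S.value K) ≤ α := by
  simp only [pairing_forward_pow] at hα
  have hs : Summable fun t => (S.backward K ^ t) (S.runningCost K) := by
    refine summable_of_sum_pairing_one_le (c := α / m)
      (h.backward_pow_nonneg K (h.runningCost_nonneg K)) fun n => ?_
    -- Since X₀ ≥ m, the trace of each stage cost is at most 1/m times that stage's pairing with X₀.
    rw [le_div_iff₀ hm, Finset.sum_mul]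
    refine le_trans (Finset.sum_le_sum fun t _ => ?_) (hα n)
    have := pairing_mono_left (h.backward_pow_nonneg K (h.runningCost_nonneg K) t) hX
    rw [map_smul, LinearMap.smul_apply, smul_eq_mul, pairing_comm] at this
    linarith
  have hv : S.value K = S.runningCost K + S.backward K (S.value K) := tsum_pow_apply_eq_add _ hs
  refine ⟨.of_runningCost_le h (value_nonneg h K) hv.ge, ?_⟩
  have := hs.hasSum.map (pairing X₀) (pairing_right_continuous X₀)
  exact le_of_tendsto' this.tendsto_sum_nat hα

end MJLS

/-! ### The exact difference formula for the cost -/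

section MatrixIdentities

variable {d k : ℕ}

/-- Completion of the square for a change of the feedback gain in the Bellman operator. -/
theorem bellman_sub_bellman {A G : Matrix (Fin d) (Fin d) ℝ} {B : Matrix (Fin d) (Fin k) ℝ}
    {R : Matrix (Fin k) (Fin k) ℝ} (K K' : Matrix (Fin k) (Fin d) ℝ) (hG : Gᵀ = G)
    (hR : Rᵀ = R) :
    K'ᵀ * R * K' + (A - B * K')ᵀ * G * (A - B * K')
        - (Kᵀ * R * K + (A - B * K)ᵀ * G * (A - B * K))
      = (K' - K)ᵀ * (R * K' - Bᵀ * G * (A - B * K'))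
        + (R * K' - Bᵀ * G * (A - B * K'))ᵀ * (K' - K)
        - (K' - K)ᵀ * (R + Bᵀ * G * B) * (K' - K) := by
  simp only [transpose_sub, transpose_mul, transpose_transpose, hG, hR, Matrix.mul_sub,
    Matrix.sub_mul, Matrix.add_mul, Matrix.mul_add, Matrix.mul_assoc]
  abel

end MatrixIdentities

section Frobenius

variable {N m n : ℕ}

/-- The squared Frobenius norm of a tuple. -/
def frobSq (D : MatTuple N m n) : ℝ := ∑ i, ((D i)ᵀ * D i).trace

theorem trace_transpose_mul_self_nonneg (D : Matrix (Fin m) (Fin n) ℝ) :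
    0 ≤ (Dᵀ * D).trace :=
  trace_nonneg_of_nonneg (transpose_mul_self_nonneg D)

theorem frobSq_nonneg (D : MatTuple N m n) : 0 ≤ frobSq D :=
  Finset.sum_nonneg fun i _ => trace_transpose_mul_self_nonneg (D i)

theorem frobSq_eq_sum_sq (D : MatTuple N m n) : frobSq D = ∑ i, ∑ a, ∑ b, D i a b ^ 2 := by
  refine Finset.sum_congr rfl fun i _ => ?_
  rw [Finset.sum_comm]
  simp [trace, mul_apply, sq]

theorem sq_apply_le_frobSq (D : MatTuple N m n) (i : Fin N) (a : Fin m) (b : Fin n) :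
    D i a b ^ 2 ≤ frobSq D := by
  rw [frobSq_eq_sum_sq]
  refine le_trans ?_ (Finset.single_le_sum (f := fun i => ∑ a, ∑ b, D i a b ^ 2)
    (fun i _ => by positivity) (Finset.mem_univ i))
  refine le_trans ?_ (Finset.single_le_sum (f := fun a => ∑ b, D i a b ^ 2)
    (fun i _ => by positivity) (Finset.mem_univ a))
  exact Finset.single_le_sum (f := fun b => D i a b ^ 2)
    (fun i _ => by positivity) (Finset.mem_univ b)

theorem frobSq_smul (c : ℝ) (D : MatTuple N m n) : frobSq (c • D) = c ^ 2 * frobSq D := by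
  simp only [frobSq_eq_sum_sq, Finset.mul_sum, Pi.smul_apply, Matrix.smul_apply,
    smul_eq_mul, mul_pow]

theorem frobSq_eq_zero {D : MatTuple N m n} : frobSq D = 0 ↔ D = 0 := by
  constructor
  · intro h
    ext i a b
    have := sq_apply_le_frobSq D i a b
    rw [h] at this
    simpa using le_antisymm this (sq_nonneg _)
  · rintro rfl
    simp [frobSq]

theorem transpose_mul_self_le_frobSq (D : MatTuple N m n) (i : Fin N) :
    (D i)ᵀ * D i ≤ frobSq D • (1 : Matrix (Fin n) (Fin n) ℝ) :=
  (le_trace_smul_one (transpose_mul_self_nonneg (D i))).trans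
    (smul_le_smul_of_nonneg_right (Finset.single_le_sum (f := fun i => ((D i)ᵀ * D i).trace)
      (fun i _ => trace_transpose_mul_self_nonneg (D i)) (Finset.mem_univ i))
      PosSemidef.one.nonneg)

end Frobenius

theorem le_two_mul_of_forall_pos {x c s : ℝ} (hc : 0 ≤ c) (hs : 0 ≤ s)
    (h : ∀ w : ℝ, 0 < w → x ≤ c * (w * s ^ 2 + w⁻¹)) : x ≤ 2 * c * s := by
  rcases hs.eq_or_lt with rfl | hs
  · by_contra! hx
    have hx : 0 < x := by simpa using hx
    -- For s = 0 the infimum over w is only approached as w grows; this w already gives x ≤ cx/(c+1)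
    -- < x. For s > 0 the optimal weight is 1/s.
    have := h ((c + 1) / x) (by positivity)
    have e : c * ((c + 1) / x * 0 ^ 2 + ((c + 1) / x)⁻¹) = c * x / (c + 1) := by
      rw [inv_div]; ring
    rw [e, le_div_iff₀ (by positivity)] at this
    linarith
  · have := h s⁻¹ (by positivity)
    have e : c * (s⁻¹ * s ^ 2 + s⁻¹⁻¹) = 2 * c * s := by
      field_simp; ring
    linarith

namespace MJLS

variable {N d k : ℕ} (S : MJLS N d k)

/-- The weight `R + Bᵀ ℰ(V) B` of the input in the Bellman operator. -/
def inputWeight (V : MatTuple N d d) : MatTuple N k k := fun i =>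
  S.R i + (S.B i)ᵀ * S.E V i * S.B i

/-- Half the derivative `R K - Bᵀ ℰ(V) (A - B K)` of the Bellman operator in the gain. -/
def gainResidual (K : MatTuple N k d) (V : MatTuple N d d) : MatTuple N k d := fun i =>
  S.R i * K i - (S.B i)ᵀ * S.E V i * S.closedLoop K i

/-- The symmetric tuple `Dᵀ M + Mᵀ D`. -/
def symProd (D M : MatTuple N k d) : MatTuple N d d := fun i => (D i)ᵀ * M i + (M i)ᵀ * D i

/-- The tuple `Dᵀ (R + Bᵀ ℰ(V) B) D`. -/
def curvature (D : MatTuple N k d) (V : MatTuple N d d) : MatTuple N d d := fun i =>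
  (D i)ᵀ * S.inputWeight V i * D i

variable {S}

theorem IsRegular.inputWeight_nonneg (h : S.IsRegular) {V : MatTuple N d d} (hV : 0 ≤ V) :
    0 ≤ S.inputWeight V := fun i =>
  add_nonneg (h.R_nonneg i) (transpose_mul_mul_nonneg (h.E_nonneg hV i) _)

theorem IsRegular.R_le_inputWeight (h : S.IsRegular) {V : MatTuple N d d} (hV : 0 ≤ V) :
    S.R ≤ S.inputWeight V := fun i =>
  le_add_of_nonneg_right (transpose_mul_mul_nonneg (h.E_nonneg hV i) _)

theorem IsRegular.curvature_nonneg (h : S.IsRegular) (D : MatTuple N k d) {V : MatTuple N d d}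
    (hV : 0 ≤ V) : 0 ≤ S.curvature D V := fun i =>
  transpose_mul_mul_nonneg (h.inputWeight_nonneg hV i) _

theorem IsRegular.bellman_sub (h : S.IsRegular) (K K' : MatTuple N k d) {V : MatTuple N d d}
    (hV : 0 ≤ V) :
    S.runningCost K' + S.backward K' V - (S.runningCost K + S.backward K V)
      = symProd (K' - K) (S.gainResidual K' V) - S.curvature (K' - K) V := by
  ext1 i
  have e := bellman_sub_bellman (A := S.A i) (B := S.B i) (K i) (K' i)
    (transpose_eq_of_nonneg (h.E_nonneg hV i)) (transpose_eq_of_nonneg (h.R_nonneg i))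
  simp only [Pi.sub_apply, Pi.add_apply, runningCost, backward_apply, symProd, curvature,
    inputWeight, gainResidual, closedLoop] at e ⊢
  rw [← e]
  abel

namespace Stable

variable (h : S.IsRegular) {K K' : MatTuple N k d} (hK : S.Stable K) (hK' : S.Stable K')
include h hK hK'

/-- Each value solves its own Bellman equation, so the left side is the difference at P^{K'} of the
Bellman operators of K' and K, to which completion of the square applies. -/
theorem value_sub_value :
    S.value K' - S.value K - S.backward K (S.value K' - S.value K)
      = symProd (K' - K) (S.gainResidual K' (S.value K')) - S.curvature (K' - K) (S.value K') := by
  rw [← h.bellman_sub K K' (value_nonneg h K'), ← hK'.value_eq h, map_sub]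
  have e : S.value K - S.backward K (S.value K) = S.runningCost K := by
    rw [sub_eq_iff_eq_add]; exact hK.value_eq h
  rw [← e]
  abel

theorem cost_sub_cost {X₀ : MatTuple N d d} (hX : 0 ≤ X₀) :
    pairing X₀ (S.value K') - pairing X₀ (S.value K)
      = pairing (S.totalCov X₀ K)
        (symProd (K' - K) (S.gainResidual K' (S.value K')) - S.curvature (K' - K) (S.value K')) := by
  rw [← hK.value_sub_value h hK', hK.pairing_totalCov h hX, map_sub]

omit hK' hK in
/-- The second order terms of the change of the cost. -/
theorem symProd_gainResidual_sub (K K' : MatTuple N k d) {V V' : MatTuple N d d} (hV : 0 ≤ V)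
    (hV' : 0 ≤ V') :
    symProd (K' - K) (S.gainResidual K' V') - S.curvature (K' - K) V'
      = symProd (K' - K) (S.gainResidual K V) + S.curvature (K' - K) V'
        - fun i => (S.B i * (K' - K) i)ᵀ * S.E (V' - V) i * S.closedLoop K i
          + (S.closedLoop K i)ᵀ * S.E (V' - V) i * (S.B i * (K' - K) i) := by
  ext1 i
  have hE := transpose_eq_of_nonneg (h.E_nonneg hV i)
  have hE' := transpose_eq_of_nonneg (h.E_nonneg hV' i)
  have hR := transpose_eq_of_nonneg (h.R_nonneg i)
  simp only [E_sub, Pi.sub_apply, Pi.add_apply, symProd, curvature, inputWeight, gainResidual,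
    closedLoop, transpose_sub, transpose_mul, transpose_transpose, hE, hE', hR, Matrix.mul_sub,
    Matrix.sub_mul, Matrix.add_mul, Matrix.mul_add, Matrix.mul_assoc]
  abel

end Stable

theorem pairing_symProd {X : MatTuple N d d} (hX : ∀ i, (X i)ᵀ = X i) (D M : MatTuple N k d) :
    pairing X (symProd D M) = 2 * ∑ i, ((D i)ᵀ * (M i * X i)).trace := by
  rw [pairing_apply, Finset.mul_sum]
  refine Finset.sum_congr rfl fun i _ => ?_
  rw [symProd, Matrix.mul_add, trace_add, two_mul]
  congr 1
  · rw [trace_mul_comm, Matrix.mul_assoc]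
  · rw [← trace_transpose]
    simp only [transpose_mul, transpose_transpose, hX]
    rw [Matrix.mul_assoc]

/-! ### Smoothness of the cost on sublevel sets -/

section Bounds

variable {X₀ : MatTuple N d d} {m q ρ b α : ℝ} (h : S.IsRegular)
  (hm : 0 < m) (hX : m • 1 ≤ X₀) (hq : 0 < q) (hqQ : q • 1 ≤ S.Q)
  (hρ : S.R ≤ ρ • 1) (hb : 0 ≤ b) (hB : ∀ i, (S.B i)ᵀ * S.B i ≤ b ^ 2 • 1)

include hm hX in
theorem initial_nonneg : 0 ≤ X₀ := (smul_nonneg hm.le tuple_one_nonneg).trans hX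

include h hm hX in
theorem Stable.value_le_smul_one {K : MatTuple N k d}
    (hα : pairing X₀ (S.value K) ≤ α) : S.value K ≤ (α / m) • 1 := by
  have hv := Stable.value_nonneg h K
  refine (le_pairing_one_smul_one hv).trans
    (smul_le_smul_of_nonneg_right ?_ tuple_one_nonneg)
  rw [le_div_iff₀ hm]
  have := pairing_mono_left hv hX
  rw [map_smul, LinearMap.smul_apply, smul_eq_mul, pairing_comm] at this
  linarith

include h hm hX hq hqQ in
-- The cost also equals ⟨X^K, Q + KᵀRK⟩, which is at least q times the trace of X^K.
theorem Stable.pairing_totalCov_one_le {K : MatTuple N k d} (hK : S.Stable K)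
    (hα : pairing X₀ (S.value K) ≤ α) : pairing (S.totalCov X₀ K) 1 ≤ α / q := by
  have hX0 := initial_nonneg hm hX
  have hc := totalCov_nonneg h hX0 K
  rw [le_div_iff₀ hq]
  have := pairing_mono_right hc (hqQ.trans (h.Q_le_runningCost K))
  rw [map_smul, smul_eq_mul, ← hK.pairing_value h hX0] at this
  linarith

include h hρ hB in
theorem inputWeight_le {V : MatTuple N d d} {c : ℝ} (hc : 0 ≤ c) (hV : V ≤ c • 1) :
    S.inputWeight V ≤ (ρ + b ^ 2 * c) • 1 := fun i => by
  have h1 := transpose_mul_mul_mono (h.E_le_smul_one hV i) (S.B i)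
  have h2 := smul_le_smul_of_nonneg_left (hB i) hc
  have e : (S.B i)ᵀ * (c • (1 : MatTuple N d d)) i * S.B i = c • ((S.B i)ᵀ * S.B i) := by
    simp
  rw [e] at h1
  have := add_le_add (hρ i) (h1.trans h2)
  refine this.trans (le_of_eq ?_)
  simp only [Pi.smul_apply, Pi.one_apply, smul_smul, ← add_smul]
  congr 2; ring

include h hρ hB in
theorem curvature_le (D : MatTuple N k d) {V : MatTuple N d d} {c : ℝ}
    (hρ0 : 0 ≤ ρ) (hc : 0 ≤ c) (hV : V ≤ c • 1) :
    S.curvature D V ≤ ((ρ + b ^ 2 * c) * frobSq D) • 1 := fun i => by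
  have h1 := transpose_mul_mul_mono (inputWeight_le h hρ hB hc hV i) (D i)
  have h2 := smul_le_smul_of_nonneg_left (transpose_mul_self_le_frobSq D i)
    (by positivity : 0 ≤ ρ + b ^ 2 * c)
  refine h1.trans (le_trans (le_of_eq ?_) (h2.trans (le_of_eq ?_)))
  · simp
  · simp [smul_smul]

include h hm hX hqQ hρ hB in
/-- The cost-to-go of nearby gains of bounded cost, relative to each other. -/
theorem Stable.value_sub_le {K K' : MatTuple N k d} (hK : S.Stable K) (hK' : S.Stable K')
    (hα : pairing X₀ (S.value K') ≤ α) (hα0 : 0 ≤ α) (hρ0 : 0 ≤ ρ) {ξ f : ℝ} (hξ : 0 ≤ ξ)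
    (hξq : q * ξ = α / m - q + (ρ + b ^ 2 * (α / m))) (hf : 0 < f)
    (hfD : frobSq (K' - K) = f ^ 2) : S.value K' - S.value K ≤ (f * ξ) • S.value K := by
  have hv' := value_nonneg h K'
  have hv'α := value_le_smul_one h hm hX hα
  have hc : 0 ≤ α / m := by positivity
  set D := K' - K with hD
  -- The Lyapunov defect of P' - P is at most fξQ, with f the Frobenius norm of D. Comparison with
  -- (1 + fξ)P then finishes, as Q is at most the running cost P - `backward` P.
  have hstep : symProd D (S.gainResidual K' (S.value K')) - S.curvature D (S.value K')
      ≤ (f * ξ) • S.Q := by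
    have hcurv0 := h.curvature_nonneg D hv'
    have hcurv := curvature_le h hρ hB D hρ0 hc hv'α
    -- Young is applied separately in the forms R and ℰ(P'). The weight f makes both resulting terms
    -- of first order: the squares of K' and of the closed loop add up to P' - Q, and the curvature
    -- carries f².
    have hsym : symProd D (S.gainResidual K' (S.value K'))
        ≤ f • (S.value K' - S.Q) + f⁻¹ • S.curvature D (S.value K') := fun i => by
      have y1 := young_of_nonneg (h.R_nonneg i) (K' i) (D i) hf
      have y2 := young_of_nonneg (h.E_nonneg hv' i) (S.closedLoop K' i) (-(S.B i * D i)) hf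
      have hE := transpose_eq_of_nonneg (h.E_nonneg hv' i)
      have hR := transpose_eq_of_nonneg (h.R_nonneg i)
      have y := add_le_add y1 y2
      have e1 : S.value K' i - S.Q i = (K' i)ᵀ * S.R i * K' i
          + (S.closedLoop K' i)ᵀ * S.E (S.value K') i * S.closedLoop K' i := by
        have := congrFun (hK'.value_eq h) i
        simp only [Pi.add_apply, runningCost, backward_apply] at this
        rw [sub_eq_iff_eq_add, this]
        abel
      simp only [Pi.add_apply, Pi.smul_apply, Pi.sub_apply]
      rw [e1]
      refine le_trans (le_of_eq ?_) (y.trans (le_of_eq ?_))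
      · simp only [symProd, gainResidual, transpose_sub, transpose_mul, transpose_transpose, hE,
          hR, transpose_neg, Matrix.mul_neg, Matrix.neg_mul, Matrix.mul_sub, Matrix.sub_mul,
          Matrix.mul_assoc]
        abel
      · simp only [curvature, inputWeight, transpose_mul, transpose_neg, Matrix.mul_neg,
          Matrix.neg_mul, neg_neg, Matrix.add_mul, Matrix.mul_add, Matrix.mul_assoc, smul_add]
        abel
    calc symProd D (S.gainResidual K' (S.value K')) - S.curvature D (S.value K')
        ≤ symProd D (S.gainResidual K' (S.value K')) := sub_le_self _ hcurv0
      _ ≤ _ := hsym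
      _ ≤ f • ((α / m) • 1 - q • 1) + f⁻¹ • (((ρ + b ^ 2 * (α / m)) * frobSq D) • 1) :=
          add_le_add (smul_le_smul_of_nonneg_left (sub_le_sub hv'α hqQ) hf.le)
            (smul_le_smul_of_nonneg_left hcurv (inv_nonneg.2 hf.le))
      _ = (f * ξ) • (q • (1 : MatTuple N d d)) := by
          rw [hfD, ← sub_smul, smul_smul, smul_smul, smul_smul, ← add_smul]
          congr 1
          rw [mul_assoc f ξ q, mul_comm ξ q, hξq]
          field_simp
      _ ≤ _ := smul_le_smul_of_nonneg_left hqQ (by positivity)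
  have hle := hK.le_of_sub_le h hv' (V := S.value K + (f * ξ) • S.value K)
    (add_nonneg (value_nonneg h K) (smul_nonneg (by positivity) (value_nonneg h K))) ?_
  · rwa [add_comm, ← sub_le_iff_le_add] at hle
  have e1 := hK.value_sub_value h hK'
  have e2 : S.value K - S.backward K (S.value K) = S.runningCost K := by
    rw [sub_eq_iff_eq_add]; exact hK.value_eq h
  have hQ := smul_le_smul_of_nonneg_left (h.Q_le_runningCost K) (by positivity : 0 ≤ f * ξ)
  rw [← sub_nonneg] at hstep hQ ⊢
  refine (add_nonneg hstep hQ).trans (le_of_eq ?_)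
  rw [← e1, ← e2]
  simp only [map_sub, map_add, map_smul, smul_sub]
  abel

include h hm hX hq hqQ hρ hb hB in
/-- Quadratic bound for the deviation of the cost from its linearization, valid for any two
gains in a sublevel set. -/
theorem Stable.abs_cost_sub_le {K K' : MatTuple N k d} (hK : S.Stable K) (hK' : S.Stable K')
    (hα : pairing X₀ (S.value K) ≤ α) (hα' : pairing X₀ (S.value K') ≤ α) (hρ0 : 0 ≤ ρ)
    {ξ : ℝ} (hξ : 0 ≤ ξ) (hξq : q * ξ = α / m - q + (ρ + b ^ 2 * (α / m))) :
    |pairing X₀ (S.value K') - pairing X₀ (S.value K)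
        - pairing (S.totalCov X₀ K) (symProd (K' - K) (S.gainResidual K (S.value K)))|
      ≤ (ρ + (b ^ 2 + 2 * ξ * b) * (α / m)) * (α / q) * frobSq (K' - K) := by
  have hX0 := initial_nonneg hm hX
  have hv := value_nonneg h K
  have hv' := value_nonneg h K'
  have hα0 : 0 ≤ α := (pairing_nonneg hX0 hv).trans hα
  have hc : 0 ≤ α / m := by positivity
  have hτ : 0 ≤ α / q := by positivity
  set D := K' - K with hD
  -- The case D = 0 is split off because the Young weight f must be positive.
  rcases (frobSq_nonneg D).eq_or_lt with h0 | hpos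
  · have hD0 := frobSq_eq_zero.1 h0.symm
    have : K' = K := sub_eq_zero.1 (hD ▸ hD0)
    have h1 : symProd (0 : MatTuple N k d) (S.gainResidual K (S.value K)) = 0 := by
      ext1 i; simp [symProd]
    rw [hD0, this, h1, frobSq_eq_zero.2 rfl]
    simp
  set f := √(frobSq D)
  have hf : 0 < f := Real.sqrt_pos.2 hpos
  have hfD : frobSq D = f ^ 2 := (Real.sq_sqrt hpos.le).symm
  have hfD' : frobSq (K - K') = f ^ 2 := by
    rw [← neg_sub, ← hD, ← neg_one_smul ℝ D, frobSq_smul, ← hfD]; ring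
  set G := S.E (S.value K' - S.value K) with hG
  set c := f * ξ * (α / m) with hc_def
  have hc0 : 0 ≤ c := by positivity
  -- The value comparison is used twice with K and K' exchanged, giving a two-sided bound on P' - P
  -- that never looks at intermediate gains.
  have hG1 : G ≤ c • 1 := h.E_le_smul_one <|
    (hK.value_sub_le h hm hX hqQ hρ hB hK' hα' hα0 hρ0 hξ hξq hf hfD).trans <| by
      rw [hc_def, mul_smul (f * ξ) (α / m)]
      exact smul_le_smul_of_nonneg_left (value_le_smul_one h hm hX hα)
        (mul_nonneg hf.le hξ)
  have hG2 : -G ≤ c • 1 := by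
    have e : -G = S.E (S.value K - S.value K') := by
      rw [hG, E_sub, E_sub, neg_sub]
    rw [e]
    refine h.E_le_smul_one <|
      (hK'.value_sub_le h hm hX hqQ hρ hB hK hα hα0 hρ0 hξ hξq hf hfD').trans ?_
    rw [hc_def, mul_smul (f * ξ) (α / m)]
    exact smul_le_smul_of_nonneg_left (value_le_smul_one h hm hX hα')
      (mul_nonneg hf.le hξ)
  set X := S.totalCov X₀ K
  have hXn : 0 ≤ X := totalCov_nonneg h hX0 K
  have hXτ : pairing X 1 ≤ α / q := hK.pairing_totalCov_one_le h hm hX hq hqQ hα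
  set W : MatTuple N d d := fun i => (S.B i * D i)ᵀ * G i * S.closedLoop K i
          + (S.closedLoop K i)ᵀ * G i * (S.B i * D i) with hW
  have hBD : ∀ i, (S.B i * D i)ᵀ * (S.B i * D i) ≤ (b ^ 2 * f ^ 2) • 1 := fun i => by
    have h1 := transpose_mul_mul_mono (hB i) (D i)
    have h2 := smul_le_smul_of_nonneg_left (transpose_mul_self_le_frobSq D i) (sq_nonneg b)
    refine le_trans (le_of_eq ?_) (h1.trans (le_trans (le_of_eq ?_) (h2.trans (le_of_eq ?_))))
    · simp only [transpose_mul, Matrix.mul_assoc]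
    · simp
    · rw [smul_smul, hfD]
  -- The mass after one more step is no larger, because `forward` X = X - X₀ ≤ X.
  have hAA : pairing X (S.backward K 1) ≤ α / q := by
    rw [← pairing_forward]
    refine le_trans ?_ hXτ
    refine pairing_mono_left tuple_one_nonneg ?_
    refine le_of_le_of_eq ?_ (hK.totalCov_eq h hX0).symm
    exact le_add_of_nonneg_left hX0
  have hbound : ∀ Y : MatTuple N d d, (∀ w : ℝ, 0 < w →
      Y ≤ c • (w • (b ^ 2 * f ^ 2) • 1 + w⁻¹ • S.backward K 1)) →
      pairing X Y ≤ 2 * (c * (α / q)) * (b * f) := fun Y hY => by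
    refine le_two_mul_of_forall_pos (by positivity) (by positivity) fun w hw => ?_
    have h1 := pairing_mono_right hXn (hY w hw)
    simp only [map_smul, map_add, smul_eq_mul] at h1
    refine h1.trans ?_
    have h2 : w * (b ^ 2 * f ^ 2 * pairing X 1) ≤ w * (b ^ 2 * f ^ 2 * (α / q)) := by gcongr
    have h3 : w⁻¹ * pairing X (S.backward K 1) ≤ w⁻¹ * (α / q) := by gcongr
    calc _ ≤ c * (w * (b ^ 2 * f ^ 2 * (α / q)) + w⁻¹ * (α / q)) :=
          mul_le_mul_of_nonneg_left (add_le_add h2 h3) hc0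
      _ = _ := by ring
  have hback : ∀ i, S.backward K 1 i = (S.closedLoop K i)ᵀ * S.closedLoop K i := fun i => by
    rw [backward_apply, h.E_one]; simp
  have hyoung : ∀ G' : MatTuple N d d, G' ≤ c • 1 → -G' ≤ c • 1 → ∀ w : ℝ, 0 < w →
      (fun i => (S.B i * D i)ᵀ * G' i * S.closedLoop K i
          + (S.closedLoop K i)ᵀ * G' i * (S.B i * D i))
        ≤ c • (w • (b ^ 2 * f ^ 2) • (1 : MatTuple N d d) + w⁻¹ • S.backward K 1) :=
    fun G' h1 h2 w hw i => by
      refine (young_of_le_of_le (h1 i) (h2 i) (S.B i * D i) (S.closedLoop K i) hw).trans ?_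
      simp only [Pi.smul_apply, Pi.add_apply, hback]
      exact smul_le_smul_of_nonneg_left (add_le_add
        (smul_le_smul_of_nonneg_left (hBD i) hw.le) le_rfl) hc0
  have hW1 : pairing X W ≤ 2 * (c * (α / q)) * (b * f) := hbound W (hyoung G hG1 hG2)
  have hW2 : pairing X (-W) ≤ 2 * (c * (α / q)) * (b * f) := by
    refine hbound (-W) fun w hw => ?_
    have := hyoung (-G) hG2 (by rwa [neg_neg]) w hw
    refine le_trans (le_of_eq ?_) this
    ext1 i
    simp only [hW, Pi.neg_apply, Matrix.mul_neg, Matrix.neg_mul]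
    abel
  have hcurv := pairing_mono_right hXn
    (curvature_le h hρ hB D hρ0 hc (value_le_smul_one h hm hX hα'))
  have hcurv0 := pairing_nonneg hXn (h.curvature_nonneg D hv')
  rw [map_smul, smul_eq_mul] at hcurv
  have hcurv' : pairing X (S.curvature D (S.value K'))
      ≤ (ρ + b ^ 2 * (α / m)) * frobSq D * (α / q) :=
    hcurv.trans (mul_le_mul_of_nonneg_left hXτ
      (mul_nonneg (by positivity) (frobSq_nonneg D)))
  rw [hK.cost_sub_cost h hK' hX0, symProd_gainResidual_sub h K K' hv hv', ← hD, ← hG]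
  have e : pairing X (symProd D (S.gainResidual K (S.value K)) + S.curvature D (S.value K') - W)
      - pairing X (symProd D (S.gainResidual K (S.value K)))
      = pairing X (S.curvature D (S.value K')) + pairing X (-W) := by
    rw [map_sub, map_add, map_neg]; ring
  have hfin : (ρ + (b ^ 2 + 2 * ξ * b) * (α / m)) * (α / q) * frobSq D
      = (ρ + b ^ 2 * (α / m)) * frobSq D * (α / q) + 2 * (c * (α / q)) * (b * f) := by
    rw [hfD, hc_def]; ring
  rw [e, hfin, abs_le]
  rw [map_neg] at hW2 ⊢
  have : 0 ≤ (ρ + b ^ 2 * (α / m)) * frobSq D * (α / q) := hcurv0.trans hcurv'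
  constructor <;> linarith

end Bounds

end MJLS

/-! ### Openness of stability and compactness of sublevel sets -/

theorem frobSq_continuous {N m n : ℕ} : Continuous (frobSq : MatTuple N m n → ℝ) := by
  unfold frobSq
  fun_prop

theorem two_smul_le_of_transpose_eq {N d : ℕ} {Z : MatTuple N d d} (hZ : ∀ i, (Z i)ᵀ = Z i)
    {w : ℝ} (hw : 0 < w) : (2 : ℝ) • Z ≤ (w * frobSq Z + w⁻¹) • 1 := fun i => by
  have h1 := young_of_nonneg (PosSemidef.one.nonneg : (0 : Matrix (Fin d) (Fin d) ℝ) ≤ 1)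
    (Z i) 1 hw
  have h2 := smul_le_smul_of_nonneg_left (transpose_mul_self_le_frobSq Z i) hw.le
  simp only [Matrix.mul_one, transpose_one, hZ i, Matrix.one_mul] at h1 h2
  simp only [Pi.smul_apply, Pi.one_apply, two_smul, add_smul, mul_smul]
  exact h1.trans (add_le_add h2 le_rfl)

theorem frobSq_mul_ge {N d k : ℕ} {X : MatTuple N d d} {m : ℝ} (hm : 0 ≤ m) (hX : m • 1 ≤ X)
    (M : MatTuple N k d) : m ^ 2 * frobSq M ≤ frobSq fun i => M i * X i := by
  rw [frobSq, frobSq, Finset.mul_sum]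
  refine Finset.sum_le_sum fun i _ => ?_
  set Y := X i - m • 1 with hY
  have hY0 : 0 ≤ Y := sub_nonneg.2 (hX i)
  have hXY : X i = Y + m • 1 := by rw [hY, sub_add_cancel]
  have hYt := transpose_eq_of_nonneg hY0
  -- Squaring is not Loewner monotone in general, but X = Y + m with Y ≥ 0 gives X² = Y² + 2mY + m².
  have hsq : (m ^ 2) • 1 ≤ X i * (X i)ᵀ := by
    have h1 := mul_mul_transpose_nonneg (PosSemidef.one.nonneg : 0 ≤ (1 : Matrix _ _ ℝ)) Y
    have h2 := smul_nonneg (by positivity : 0 ≤ 2 * m) hY0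
    rw [← sub_nonneg]
    refine (add_nonneg h1 h2).trans (le_of_eq ?_)
    rw [hXY, transpose_add, hYt]
    simp only [transpose_smul, transpose_one, Matrix.add_mul, Matrix.mul_add, Matrix.mul_smul,
      Matrix.smul_mul, Matrix.mul_one, Matrix.one_mul, two_mul, add_smul, sq, smul_add, mul_smul]
    abel
  have := trace_mul_mono_right (transpose_mul_self_nonneg (M i)) hsq
  rw [Matrix.mul_smul, Matrix.mul_one, trace_smul, smul_eq_mul] at this
  refine this.trans (le_of_eq ?_)
  rw [transpose_mul, Matrix.mul_assoc (X i)ᵀ, trace_mul_comm (X i)ᵀ]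
  simp only [Matrix.mul_assoc]

namespace MJLS

variable {N d k : ℕ} {S : MJLS N d k}

theorem runningCost_continuous : Continuous S.runningCost := by
  unfold runningCost
  fun_prop

theorem closedLoop_continuous : Continuous S.closedLoop := by
  unfold closedLoop
  fun_prop

theorem backward_continuous (V : MatTuple N d d) : Continuous fun K => S.backward K V := by
  have := S.closedLoop_continuous
  refine continuous_pi fun i => ?_
  simp only [backward_apply]
  fun_prop

theorem forward_pow_continuous (X : MatTuple N d d) (t : ℕ) :
    Continuous fun K => (S.forward K ^ t) X := by
  have := S.closedLoop_continuous
  induction t with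
  | zero => simpa using continuous_const
  | succ t ih =>
    simp only [pow_succ', Module.End.mul_apply]
    refine continuous_pi fun j => ?_
    simp only [forward_apply]
    fun_prop

theorem sum_cost_continuous (X : MatTuple N d d) (n : ℕ) : Continuous fun K =>
    ∑ t ∈ Finset.range n, pairing ((S.forward K ^ t) X) (S.runningCost K) := by
  refine continuous_finsetSum _ fun t _ => ?_
  have h1 := S.forward_pow_continuous X t
  have h2 := S.runningCost_continuous
  simp only [pairing_apply]
  fun_prop

variable (h : S.IsRegular) {X₀ : MatTuple N d d} {m : ℝ} (hm : 0 < m) (hX : m • 1 ≤ X₀)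

include h in
-- The Bellman defect Z of P^K at a nearby gain is small by continuity; as soon as 2Z ≤ Q, the tuple
-- 2P^K is a supersolution there.
theorem Stable.eventually {K : MatTuple N k d} (hK : S.Stable K) :
    ∀ᶠ K' in 𝓝 K, S.Stable K' ∧ S.value K' ≤ (2 : ℝ) • S.value K := by
  obtain ⟨q, hq, hqQ⟩ := h.exists_smul_one_le_Q
  have hv := value_nonneg h K
  set Z : MatTuple N k d → MatTuple N d d := fun K' =>
    S.runningCost K' + S.backward K' (S.value K) - S.value K with hZ
  have hZc : Continuous fun K' => frobSq (Z K') := frobSq_continuous.comp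
    ((S.runningCost_continuous.add (S.backward_continuous _)).sub continuous_const)
  have hZ0 : frobSq (Z K) = 0 := by
    rw [hZ]
    simp only
    rw [← hK.value_eq h, sub_self, frobSq_eq_zero.2 rfl]
  have hev : ∀ᶠ K' in 𝓝 K, frobSq (Z K') < q ^ 2 / 4 :=
    hZc.continuousAt.eventually_lt continuousAt_const (by simp only [hZ0]; positivity)
  refine hev.mono fun K' hK' => ?_
  have hrc := h.runningCost_nonneg K'
  have hsym : ∀ i, (Z K' i)ᵀ = Z K' i := fun i => by
    have h1 := transpose_eq_of_nonneg ((add_nonneg hrc (h.backward_nonneg K' hv)) i)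
    have h2 := transpose_eq_of_nonneg (hv i)
    simp only [hZ, Pi.sub_apply, transpose_sub, h1, h2]
  -- With this weight and |Z|² < q²/4, the two Young terms are each at most q/2.
  have hle := two_smul_le_of_transpose_eq hsym (w := 2 / q) (by positivity)
  have hle2 : (2 : ℝ) • Z K' ≤ S.Q := by
    refine hle.trans ((smul_le_smul_of_nonneg_right ?_ tuple_one_nonneg).trans hqQ)
    calc 2 / q * frobSq (Z K') + (2 / q)⁻¹ ≤ 2 / q * (q ^ 2 / 4) + (2 / q)⁻¹ := by gcongr
      _ = q := by field_simp; ring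
  have hnn : 0 ≤ (2 : ℝ) • S.value K := smul_nonneg zero_le_two hv
  have hlyap : S.runningCost K' + S.backward K' ((2 : ℝ) • S.value K) ≤ (2 : ℝ) • S.value K := by
    have h3 := hle2.trans (h.Q_le_runningCost K')
    rw [← sub_nonneg] at h3 ⊢
    refine h3.trans (le_of_eq ?_)
    rw [hZ, map_smul]
    simp only [two_smul]
    abel
  have hst := Stable.of_runningCost_le h hnn hlyap
  exact ⟨hst, hst.value_le h hnn hlyap⟩

include h in
theorem Stable.sum_cost_le (hX0 : 0 ≤ X₀) {K : MatTuple N k d} (hK : S.Stable K) (n : ℕ) :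
    ∑ t ∈ Finset.range n, pairing ((S.forward K ^ t) X₀) (S.runningCost K)
      ≤ pairing X₀ (S.value K) := by
  simp only [pairing_forward_pow]
  rw [← map_sum]
  have hrc := h.runningCost_nonneg K
  exact pairing_mono_right hX0
    ((hK.summable_backward h hrc).sum_le_tsum _ fun t _ => h.backward_pow_nonneg K hrc t)

include h hm hX in
-- The stable gains alone are an open set. Bounds on all partial costs are closed conditions,
-- however, and as X₀ is nondegenerate they already force stability.
theorem isClosed_sublevel (α : ℝ) :
    IsClosed {K | S.Stable K ∧ pairing X₀ (S.value K) ≤ α} := by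
  have : {K | S.Stable K ∧ pairing X₀ (S.value K) ≤ α} = ⋂ n, {K |
      ∑ t ∈ Finset.range n, pairing ((S.forward K ^ t) X₀) (S.runningCost K) ≤ α} := by
    ext K
    simp only [Set.mem_ofPred_eq, Set.mem_iInter]
    exact ⟨fun hK n => (hK.1.sum_cost_le h (initial_nonneg hm hX) n).trans hK.2,
      fun hK => Stable.of_sum_le h hm hX hK⟩
  rw [this]
  exact isClosed_iInter fun n => isClosed_le (sum_cost_continuous X₀ n) continuous_const

include h hm hX in
theorem Stable.smul_one_le_totalCov {K : MatTuple N k d} (hK : S.Stable K) :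
    m • 1 ≤ S.totalCov X₀ K := hX.trans (hK.le_totalCov h (initial_nonneg hm hX))

include h hm hX in
theorem Stable.frobSq_le {K : MatTuple N k d} (hK : S.Stable K) {r : ℝ} (hr : 0 ≤ r)
    (hrR : r • 1 ≤ S.R) : m * r * frobSq K ≤ pairing X₀ (S.value K) := by
  have hX0 := initial_nonneg hm hX
  rw [hK.pairing_value h hX0]
  have hle : r • (fun i => (K i)ᵀ * K i : MatTuple N d d) ≤ S.runningCost K := fun i => by
    have := transpose_mul_mul_mono (hrR i) (K i)
    refine le_trans (le_of_eq ?_) (this.trans (le_add_of_nonneg_left (h.Q_nonneg i)))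
    simp
  have h1 := pairing_mono_right (totalCov_nonneg h hX0 K) hle
  have hnn : 0 ≤ r • (fun i => (K i)ᵀ * K i : MatTuple N d d) :=
    smul_nonneg hr fun i => transpose_mul_self_nonneg (K i)
  have h2 := pairing_mono_left hnn (hK.smul_one_le_totalCov h hm hX)
  refine le_trans (le_of_eq ?_) (h2.trans h1)
  rw [map_smul, map_smul, LinearMap.smul_apply, pairing_comm, pairing_one, frobSq, smul_eq_mul,
    smul_eq_mul]
  ring

include h hm hX in
theorem isCompact_sublevel (α : ℝ) :
    IsCompact {K | S.Stable K ∧ pairing X₀ (S.value K) ≤ α} := by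
  obtain ⟨r, hr, hrR⟩ := h.exists_smul_one_le_R
  -- Adding 1 avoids a square root: a ≤ (a + 1)² for a ≥ 0.
  set c := α / (m * r) + 1
  have hbox : IsCompact (Set.pi Set.univ fun _ : Fin N => Set.pi Set.univ fun _ : Fin k =>
      Set.pi Set.univ fun _ : Fin d => Set.Icc (-c) c : Set (MatTuple N k d)) :=
    isCompact_univ_pi fun _ => isCompact_univ_pi fun _ => isCompact_univ_pi fun _ => isCompact_Icc
  refine hbox.of_isClosed_subset (isClosed_sublevel h hm hX α) fun K hK i _ a _ b _ => ?_
  have h1 := (hK.1.frobSq_le h hm hX hr.le hrR).trans hK.2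
  have h2 : frobSq K ≤ α / (m * r) := by
    rw [le_div_iff₀ (by positivity)]; linarith
  have h3 := sq_apply_le_frobSq K i a b
  have h4 : 0 ≤ α / (m * r) := (frobSq_nonneg K).trans h2
  refine Set.mem_Icc.2 (abs_le.1 ?_)
  refine abs_le_of_sq_le_sq ?_ (by positivity)
  simp only [c]
  nlinarith

include h hm hX in
/-- Near a stable gain the cost deviates at most quadratically from its linearization. -/
theorem Stable.eventually_abs_cost_sub_le {K : MatTuple N k d} (hK : S.Stable K) :
    ∃ c : ℝ, 0 ≤ c ∧ ∀ᶠ K' in 𝓝 K, S.Stable K' ∧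
      |pairing X₀ (S.value K') - pairing X₀ (S.value K)
        - pairing (S.totalCov X₀ K) (symProd (K' - K) (S.gainResidual K (S.value K)))|
      ≤ c * frobSq (K' - K) := by
  obtain ⟨q, hq, hqQ⟩ := h.exists_smul_one_le_Q
  have hX0 := initial_nonneg hm hX
  have hρ : S.R ≤ maxNorm S.R • 1 := le_maxNorm_smul_one fun i =>
    transpose_eq_of_nonneg (h.R_nonneg i)
  have hB := transpose_mul_self_le_maxNorm S.B
  have hρ0 := maxNorm_nonneg S.R
  have hb := maxNorm_nonneg S.B
  generalize maxNorm S.R = ρ at *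
  generalize maxNorm S.B = b at *
  have hC0 := pairing_nonneg hX0 (value_nonneg h K)
  -- The factor 2 leaves room for nearby gains, whose value is at most twice that of K; the term m q
  -- ensures q ≤ α/m, hence ξ ≥ 0.
  set α := 2 * pairing X₀ (S.value K) + m * q with hα
  have hαm : q ≤ α / m := by
    rw [le_div_iff₀ hm]; linarith
  have hα0 : 0 ≤ α := by positivity
  set ξ := (α / m - q + (ρ + b ^ 2 * (α / m))) / q with hξ_def
  have hαm0 : 0 ≤ α / m := by positivity
  have hξ : 0 ≤ ξ := div_nonneg (by nlinarith [mul_nonneg (sq_nonneg b) hαm0]) hq.le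
  have hξq : q * ξ = α / m - q + (ρ + b ^ 2 * (α / m)) := by
    rw [hξ_def, mul_div_cancel₀ _ hq.ne']
  refine ⟨(ρ + (b ^ 2 + 2 * ξ * b) * (α / m)) * (α / q), by positivity,
    (hK.eventually h).mono fun K' hK' => ⟨hK'.1, ?_⟩⟩
  refine hK.abs_cost_sub_le h hm hX hq hqQ hρ hb hB hK'.1 ?_ ?_ hρ0 hξ hξq
  · have : 0 < m * q := by positivity
    linarith
  · have := pairing_mono_right hX0 hK'.2
    rw [map_smul, smul_eq_mul] at this
    have : 0 < m * q := by positivity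
    linarith

end MJLS

/-! ### The gradient of the cost -/

section FrobeniusInner

variable {N m n : ℕ}

/-- The functional `D ↦ ∑ i, tr ((D i)ᵀ * G i)`. -/
def frobInner (G : MatTuple N m n) : MatTuple N m n →ₗ[ℝ] ℝ where
  toFun D := ∑ i, ((D i)ᵀ * G i).trace
  map_add' D D' := by simp [Matrix.add_mul, Finset.sum_add_distrib]
  map_smul' c D := by simp [Finset.mul_sum]

theorem frobInner_apply (G D : MatTuple N m n) :
    frobInner G D = ∑ i, ((D i)ᵀ * G i).trace := rfl

theorem frobInner_self (G : MatTuple N m n) : frobInner G G = frobSq G := rfl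

theorem frobInner_single (G : MatTuple N m n) (i : Fin N) (a : Fin m) (b : Fin n) :
    frobInner G (Pi.single i (Matrix.single a b 1)) = G i a b := by
  rw [frobInner_apply, Finset.sum_eq_single i]
  · simp [trace, mul_apply, Matrix.single_apply, Finset.sum_ite_eq, ite_and]
  · intro j _ hj
    simp [Pi.single_eq_of_ne hj]
  · simp

end FrobeniusInner

section Derivative

open scoped Matrix.Norms.Elementwise

variable {N m n : ℕ}

theorem hasFDerivAt_of_abs_sub_le_frobSq {f : MatTuple N m n → ℝ}
    {f' : MatTuple N m n →L[ℝ] ℝ} {K : MatTuple N m n} {c : ℝ} (hc : 0 ≤ c)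
    (h : ∀ᶠ K' in 𝓝 K, |f K' - f K - f' (K' - K)| ≤ c * frobSq (K' - K)) :
    HasFDerivAt f f' K := by
  refine hasFDerivAt_iff_isLittleO.2 ?_
  refine Asymptotics.IsBigO.trans_isLittleO ?_
    (Asymptotics.isLittleO_pow_sub_sub K one_lt_two)
  refine Asymptotics.IsBigO.of_bound (c * (N * (m * n))) (h.mono fun K' hK' => ?_)
  rw [Real.norm_eq_abs, Real.norm_eq_abs, abs_of_nonneg (sq_nonneg ‖K' - K‖), mul_assoc]
  refine hK'.trans (mul_le_mul_of_nonneg_left ?_ hc)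
  rw [frobSq_eq_sum_sq]
  have hent : ∀ i a b, (K' - K) i a b ^ 2 ≤ ‖K' - K‖ ^ 2 := fun i a b => by
    rw [← sq_abs]
    refine pow_le_pow_left₀ (abs_nonneg _) ?_ 2
    exact (Matrix.norm_entry_le_entrywise_sup_norm _).trans (norm_le_pi_norm (K' - K) i)
  calc ∑ i, ∑ a, ∑ b, (K' - K) i a b ^ 2
      ≤ ∑ _i : Fin N, ∑ _a : Fin m, ∑ _b : Fin n, ‖K' - K‖ ^ 2 :=
        Finset.sum_le_sum fun i _ => Finset.sum_le_sum fun a _ => Finset.sum_le_sum fun b _ =>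
          hent i a b
    _ = _ := by
        simp only [Finset.sum_const, Finset.card_univ, Fintype.card_fin, nsmul_eq_mul]
        ring

theorem hasFDerivAt_eq_zero_of_isLocalMin {f : MatTuple N m n → ℝ}
    {f' : MatTuple N m n →L[ℝ] ℝ} {K : MatTuple N m n} (h : IsLocalMin f K)
    (hf : HasFDerivAt f f' K) : f' = 0 :=
  IsLocalMin.hasFDerivAt_eq_zero (f := f) (f' := f') (a := K) h hf

end Derivative

namespace MJLS

variable {N d k : ℕ} {S : MJLS N d k}

variable (S) in
/-- The gradient `2 (R K - Bᵀ ℰ(P) (A - B K)) X` of the cost. -/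
def costGradient (X₀ : MatTuple N d d) (K : MatTuple N k d) : MatTuple N k d := fun i =>
  (2 : ℝ) • (S.gainResidual K (S.value K) i * S.totalCov X₀ K i)

variable (h : S.IsRegular) {X₀ : MatTuple N d d} {m : ℝ} (hm : 0 < m) (hX : m • 1 ≤ X₀)

include h in
theorem pairing_totalCov_symProd (hX0 : 0 ≤ X₀) (K D : MatTuple N k d) :
    pairing (S.totalCov X₀ K) (symProd D (S.gainResidual K (S.value K)))
      = frobInner (S.costGradient X₀ K) D := by
  rw [pairing_symProd fun i => transpose_eq_of_nonneg (Stable.totalCov_nonneg h hX0 K i),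
    frobInner_apply, Finset.mul_sum]
  simp [costGradient]

include h hm hX in
theorem Stable.hasFDerivAt {K : MatTuple N k d} (hK : S.Stable K) :
    HasFDerivAt (fun K => pairing X₀ (S.value K))
      (frobInner (S.costGradient X₀ K)).toContinuousLinearMap K := by
  obtain ⟨c, hc, hev⟩ := hK.eventually_abs_cost_sub_le h hm hX
  refine hasFDerivAt_of_abs_sub_le_frobSq hc (hev.mono fun K' hK' => ?_)
  have := hK'.2
  rwa [pairing_totalCov_symProd h (initial_nonneg hm hX)] at this

include h hm hX in
theorem Stable.continuousAt {K : MatTuple N k d} (hK : S.Stable K) :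
    ContinuousAt (fun K => pairing X₀ (S.value K)) K :=
  (hK.hasFDerivAt h hm hX).continuousAt

include h hm hX in
theorem Stable.frobSq_costGradient_ge {K : MatTuple N k d} (hK : S.Stable K) :
    4 * m ^ 2 * frobSq (S.gainResidual K (S.value K)) ≤ frobSq (S.costGradient X₀ K) := by
  have := frobSq_mul_ge hm.le (hK.smul_one_le_totalCov h hm hX) (S.gainResidual K (S.value K))
  have e : S.costGradient X₀ K = (2 : ℝ) • fun i =>
    S.gainResidual K (S.value K) i * S.totalCov X₀ K i := rfl
  rw [e, frobSq_smul]
  linarith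

/-! ### Minimizers and the coupled Riccati equations -/

include h hm hX in
theorem exists_stable_gainResidual_eq_zero (hne : ∃ K, S.Stable K) :
    ∃ K, S.Stable K ∧ S.gainResidual K (S.value K) = 0 := by
  obtain ⟨K₀, hK₀⟩ := hne
  obtain ⟨K, hK, hmin⟩ := (isCompact_sublevel h hm hX (pairing X₀ (S.value K₀))).exists_isMinOn
    ⟨K₀, hK₀, le_rfl⟩ fun K hK => (hK.1.continuousAt h hm hX).continuousWithinAt
  have hloc : IsLocalMin (fun K => pairing X₀ (S.value K)) K := by
    filter_upwards [hK.1.eventually h] with K' hK'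
    -- Nearby gains outside the sublevel set cost more than K₀, hence more than the minimizer.
    by_cases hle : pairing X₀ (S.value K') ≤ pairing X₀ (S.value K₀)
    · exact hmin ⟨hK'.1, hle⟩
    · exact hK.2.trans (not_le.1 hle).le
  have h0 := hasFDerivAt_eq_zero_of_isLocalMin hloc (hK.1.hasFDerivAt h hm hX)
  have h1 : frobSq (S.costGradient X₀ K) = 0 := by
    rw [← frobInner_self]
    exact DFunLike.congr_fun h0 (S.costGradient X₀ K)
  have h2 := hK.1.frobSq_costGradient_ge h hm hX
  refine ⟨K, hK.1, frobSq_eq_zero.1 (le_antisymm ?_ (frobSq_nonneg _))⟩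
  rw [h1] at h2
  exact nonpos_of_mul_nonpos_right h2 (by positivity)

include h in
theorem IsRegular.posDef_inputWeight {V : MatTuple N d d} (hV : 0 ≤ V) (i : Fin N) :
    (S.inputWeight V i).PosDef :=
  (h.posDef_R i).add_posSemidef
    (nonneg_iff_posSemidef.1 (transpose_mul_mul_nonneg (h.E_nonneg hV i) _))

theorem gainResidual_eq (K : MatTuple N k d) (V : MatTuple N d d) (i : Fin N) :
    S.gainResidual K V i = S.inputWeight V i * K i - (S.B i)ᵀ * S.E V i * S.A i := by
  simp only [gainResidual, inputWeight, closedLoop, Matrix.mul_sub, Matrix.add_mul,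
    Matrix.mul_assoc]
  abel

include h in
theorem gainResidual_eq_zero_iff {K : MatTuple N k d} {V : MatTuple N d d} (hV : 0 ≤ V) :
    S.gainResidual K V = 0 ↔ K = S.riccatiGain V := by
  have key : ∀ i, S.gainResidual K V i = 0 ↔ K i = S.riccatiGain V i := fun i => by
    have hU := (h.posDef_inputWeight hV i).isUnit
    have hdet := (isUnit_iff_isUnit_det _).1 hU
    rw [gainResidual_eq, sub_eq_zero]
    have e : S.riccatiGain V i
        = (S.inputWeight V i)⁻¹ * ((S.B i)ᵀ * S.E V i * S.A i) := by
      simp only [riccatiGain, inputWeight, Matrix.mul_assoc]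
    rw [e]
    constructor
    · intro hK
      rw [← hK, nonsing_inv_mul_cancel_left _ _ hdet]
    · intro hK
      rw [hK, mul_nonsing_inv_cancel_left _ _ hdet]
  exact ⟨fun hK => funext fun i => (key i).1 (congrFun hK i),
    fun hK => funext fun i => (key i).2 (congrFun hK i)⟩

include h in
/-- At the Riccati gain the Bellman operator is the Riccati operator. -/
theorem runningCost_add_backward_riccatiGain {V : MatTuple N d d} (hV : 0 ≤ V) (i : Fin N) :
    (S.runningCost (S.riccatiGain V) + S.backward (S.riccatiGain V) V) i
      = S.Q i + (S.A i)ᵀ * S.E V i * S.A i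
        - (S.A i)ᵀ * S.E V i * S.B i * (S.R i + (S.B i)ᵀ * S.E V i * S.B i)⁻¹
          * (S.B i)ᵀ * S.E V i * S.A i := by
  have h0 := congrFun ((gainResidual_eq_zero_iff h hV).2 rfl) i
  rw [gainResidual_eq, Pi.zero_apply] at h0
  -- The Bellman operator differs from the Riccati expression exactly by the transposed gain times
  -- the residual, which vanishes.
  have h1 := congrArg (fun Y => (S.riccatiGain V i)ᵀ * Y) h0
  have e : (S.A i)ᵀ * S.E V i * S.B i * (S.R i + (S.B i)ᵀ * S.E V i * S.B i)⁻¹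
      * (S.B i)ᵀ * S.E V i * S.A i = (S.A i)ᵀ * S.E V i * S.B i * S.riccatiGain V i := by
    simp only [riccatiGain, Matrix.mul_assoc]
  rw [e, ← sub_eq_zero]
  generalize S.riccatiGain V = K at *
  simp only [Matrix.mul_zero] at h1
  rw [← h1]
  simp only [Pi.add_apply, runningCost, backward_apply, closedLoop, inputWeight, transpose_sub,
    transpose_mul, Matrix.mul_sub, Matrix.sub_mul, Matrix.mul_add, Matrix.add_mul,
    Matrix.mul_assoc]
  abel

include h in
theorem Stable.isRiccatiSolution {K : MatTuple N k d} (hK : S.Stable K)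
    (h0 : S.gainResidual K (S.value K) = 0) :
    S.IsRiccatiSolution (S.value K) ∧ K = S.riccatiGain (S.value K) := by
  have hv := value_nonneg h K
  have hgain := (gainResidual_eq_zero_iff h hv).1 h0
  refine ⟨⟨fun i => ?_, fun i => ?_⟩, hgain⟩
  · have := (h.posDef_Q i).add_posSemidef
      (nonneg_iff_posSemidef.1 (sub_nonneg.2 (hK.Q_le_value h i)))
    rwa [add_sub_cancel] at this
  · rw [← runningCost_add_backward_riccatiGain h hv i, ← hgain]
    exact congrFun (hK.value_eq h) i

include h in
-- P is its own Lyapunov function for its gain, so uniqueness needs no prior stability assumption.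
theorem IsRiccatiSolution.stable {P : MatTuple N d d} (hP : S.IsRiccatiSolution P) :
    S.Stable (S.riccatiGain P) ∧ P = S.value (S.riccatiGain P) ∧
      S.gainResidual (S.riccatiGain P) P = 0 := by
  have hP0 : 0 ≤ P := fun i => (hP.1 i).posSemidef.nonneg
  have heq : P = S.runningCost (S.riccatiGain P) + S.backward (S.riccatiGain P) P :=
    funext fun i => (hP.2 i).trans (runningCost_add_backward_riccatiGain h hP0 i).symm
  have hst := Stable.of_runningCost_le h hP0 heq.ge
  exact ⟨hst, hst.eq_value h hP0 heq, (gainResidual_eq_zero_iff h hP0).2 rfl⟩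

section Optimal

variable {K Ks : MatTuple N k d} (hK : S.Stable K) (hKs : S.Stable Ks)
  (h0 : S.gainResidual Ks (S.value Ks) = 0)

include h hK hKs h0

theorem value_sub_optimal :
    S.value K - S.value Ks - S.backward K (S.value K - S.value Ks)
      = S.curvature (Ks - K) (S.value Ks) := by
  have e := hK.value_sub_value h hKs
  have hz : symProd (Ks - K) (S.gainResidual Ks (S.value Ks)) = 0 := by
    rw [h0]; ext1 i; simp [symProd]
  rw [hz, zero_sub] at e
  rw [← neg_inj, ← e]
  simp only [map_sub]
  abel

/-- The optimal cost-to-go is minimal in the Loewner order, so optimality does not depend on the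
initial distribution; applied both ways it yields uniqueness. -/
theorem value_optimal_le : S.value Ks ≤ S.value K := by
  refine hK.le_of_sub_le h (Stable.value_nonneg h Ks) (Stable.value_nonneg h K) ?_
  rw [← sub_nonneg, value_sub_optimal h hK hKs h0]
  exact h.curvature_nonneg _ (Stable.value_nonneg h Ks)

include hm hX in
-- Quadratic growth: the excess cost is the curvature term weighted by X^K ≥ m. It turns convergence
-- of costs into convergence of gains.
theorem frobSq_sub_optimal_le {r : ℝ} (hr : 0 ≤ r) (hrR : r • 1 ≤ S.R) :
    m * r * frobSq (K - Ks) ≤ pairing X₀ (S.value K) - pairing X₀ (S.value Ks) := by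
  have hX0 := initial_nonneg hm hX
  rw [← map_sub, ← hK.pairing_totalCov h hX0, value_sub_optimal h hK hKs h0]
  set D := Ks - K with hD
  have hle : r • (fun i => (D i)ᵀ * D i : MatTuple N d d) ≤ S.curvature D (S.value Ks) :=
    fun i => by
      have := transpose_mul_mul_mono
        ((hrR.trans (h.R_le_inputWeight (Stable.value_nonneg h Ks))) i) (D i)
      refine le_trans (le_of_eq ?_) this
      simp
  have h1 := pairing_mono_right (Stable.totalCov_nonneg h hX0 K) hle
  have hnn : 0 ≤ r • (fun i => (D i)ᵀ * D i : MatTuple N d d) :=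
    smul_nonneg hr fun i => transpose_mul_self_nonneg (D i)
  have h2 := pairing_mono_left hnn (hK.smul_one_le_totalCov h hm hX)
  have hneg : frobSq (K - Ks) = frobSq D := by
    rw [← neg_sub, ← hD, ← neg_one_smul ℝ D, frobSq_smul]; ring
  refine le_trans (le_of_eq ?_) (h2.trans h1)
  rw [hneg, map_smul, map_smul, LinearMap.smul_apply, pairing_comm, pairing_one, frobSq,
    smul_eq_mul, smul_eq_mul]
  ring

end Optimal

/-! ### Gradient dominance and the descent step -/

include h hm hX in
/-- Gradient dominance of the cost. -/
theorem Stable.cost_sub_le_frobSq_costGradient {K Ks : MatTuple N k d} (hK : S.Stable K)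
    (hKs : S.Stable Ks) {r χ : ℝ} (hr : 0 < r) (hrR : r • 1 ≤ S.R)
    (hχ : S.totalCov X₀ Ks ≤ χ • 1) (hχ0 : 0 ≤ χ) :
    4 * m ^ 2 * r * (pairing X₀ (S.value K) - pairing X₀ (S.value Ks))
      ≤ χ * frobSq (S.costGradient X₀ K) := by
  have hX0 := initial_nonneg hm hX
  set M := S.gainResidual K (S.value K) with hM
  -- The difference formula is based at `Ks`, so the weight is the fixed X^{K*} and D is only a
  -- variable to maximize out: DᵀM + MᵀD - rDᵀD ≤ r⁻¹MᵀM.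
  have hle : symProd (K - Ks) M - S.curvature (K - Ks) (S.value K)
      ≤ r⁻¹ • (fun i => (M i)ᵀ * M i : MatTuple N d d) := fun i => by
    have y := young_of_nonneg (PosSemidef.one.nonneg : 0 ≤ (1 : Matrix (Fin k) (Fin k) ℝ))
      ((K - Ks) i) (M i) hr
    have hc := transpose_mul_mul_mono
        ((hrR.trans (h.R_le_inputWeight (value_nonneg h K))) i) ((K - Ks) i)
    simp only [Matrix.mul_one, Pi.smul_apply, Pi.one_apply, Matrix.mul_smul,
      Matrix.smul_mul] at y hc
    have := sub_le_sub y hc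
    rwa [add_sub_cancel_left] at this
  have h1 := pairing_mono_right (totalCov_nonneg h hX0 Ks) hle
  have hnn : 0 ≤ r⁻¹ • (fun i => (M i)ᵀ * M i : MatTuple N d d) :=
    smul_nonneg (inv_nonneg.2 hr.le) fun i => transpose_mul_self_nonneg (M i)
  have h2 := h1.trans (pairing_mono_left hnn hχ)
  rw [← hKs.cost_sub_cost h hK hX0, map_smul, map_smul, LinearMap.smul_apply,
    pairing_comm 1, pairing_one, smul_eq_mul, smul_eq_mul] at h2
  have h3 := hK.frobSq_costGradient_ge h hm hX
  have h4 : 4 * m ^ 2 * r * (pairing X₀ (S.value K) - pairing X₀ (S.value Ks))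
      ≤ 4 * m ^ 2 * r * (r⁻¹ * (χ * frobSq M)) :=
    mul_le_mul_of_nonneg_left h2 (by positivity)
  calc _ ≤ _ := h4
    _ = χ * (4 * m ^ 2 * frobSq M) := by field_simp
    _ ≤ _ := mul_le_mul_of_nonneg_left h3 hχ0

include h hm hX in
/-- One gradient step with a step size below the inverse smoothness constant of the sublevel
set stays in the sublevel set and decreases the cost. -/
theorem Stable.descent {q ρ b α : ℝ} (hq : 0 < q) (hqQ : q • 1 ≤ S.Q) (hρ : S.R ≤ ρ • 1)
    (hρ0 : 0 ≤ ρ) (hb : 0 ≤ b) (hB : ∀ i, (S.B i)ᵀ * S.B i ≤ b ^ 2 • 1) {ξ : ℝ} (hξ : 0 ≤ ξ)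
    (hξq : q * ξ = α / m - q + (ρ + b ^ 2 * (α / m))) {K : MatTuple N k d} (hK : S.Stable K)
    (hα : pairing X₀ (S.value K) ≤ α) {η : ℝ} (hη : 0 < η)
    (hηL : η * (2 * (ρ + (b ^ 2 + 2 * ξ * b) * (α / m)) * (α / q)) ≤ 1) :
    S.Stable (K - η • S.costGradient X₀ K) ∧
      pairing X₀ (S.value (K - η • S.costGradient X₀ K))
        ≤ pairing X₀ (S.value K) - η / 2 * frobSq (S.costGradient X₀ K) := by
  have hX0 := initial_nonneg hm hX
  set G := S.costGradient X₀ K with hG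
  set β := pairing X₀ (S.value K) with hβ
  rcases (frobSq_nonneg G).eq_or_lt with hg | hg
  · rw [← hg, frobSq_eq_zero.1 hg.symm]
    simpa [hβ] using hK
  set s : Set ℝ := {t | S.Stable (K - t • G) ∧ pairing X₀ (S.value (K - t • G)) ≤ β} with hs
  have hline : Continuous fun t : ℝ => K - t • G := by fun_prop
  have hlin : ∀ t : ℝ, pairing (S.totalCov X₀ K)
      (symProd (K - t • G - K) (S.gainResidual K (S.value K))) = -(t * frobSq G) := fun t => by
    rw [pairing_totalCov_symProd h hX0, ← hG, sub_sub_cancel_left, map_neg, map_smul,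
      frobInner_self, smul_eq_mul]
  have hfrob : ∀ t : ℝ, frobSq (K - t • G - K) = t ^ 2 * frobSq G := fun t => by
    rw [sub_sub_cancel_left, ← neg_smul, frobSq_smul]; ring
  have hdec : ∀ t ∈ s, 0 ≤ t → t ≤ η →
      pairing X₀ (S.value (K - t • G)) ≤ β - t / 2 * frobSq G := fun t ht ht0 htη => by
    have hbd := hK.abs_cost_sub_le h hm hX hq hqQ hρ hb hB ht.1 hα (ht.2.trans hα) hρ0 hξ hξq
    rw [hlin, hfrob, ← hβ] at hbd
    have hle := (abs_le.1 hbd).2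
    have hα0 : 0 ≤ α := (pairing_nonneg hX0 (value_nonneg h K)).trans hα
    set c := (ρ + (b ^ 2 + 2 * ξ * b) * (α / m)) * (α / q) with hc
    have hc0 : 0 ≤ c := by positivity
    have hηc : t * c ≤ 1 / 2 := by
      have : η * (2 * c) ≤ 1 := by rw [hc, ← mul_assoc 2]; exact hηL
      nlinarith
    have h2 : c * (t ^ 2 * frobSq G) ≤ t / 2 * frobSq G := by
      have : t * c * (t * frobSq G) ≤ 1 / 2 * (t * frobSq G) :=
        mul_le_mul_of_nonneg_right hηc (by positivity)
      linarith
    linarith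
  -- Sublevel sets need not be convex, so the ray is followed by continuous induction: the
  -- admissible set of t is closed and can be extended to the right of each of its points.
  have hsub : Set.Icc 0 η ⊆ s := by
    refine IsClosed.Icc_subset_of_forall_exists_gt ?_ ⟨by simpa using hK, by simp [hβ]⟩ ?_
    · exact ((isClosed_sublevel h hm hX β).preimage hline).inter isClosed_Icc
    · rintro t ⟨hts, ht0, htη⟩ y hy
      have hev : ∀ᶠ t' in 𝓝[>] t, t' ∈ s := by
        rcases ht0.eq_or_lt with rfl | htpos
        -- At t = 0 the cost equals β exactly, leaving no slack for continuity; the first-order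
        -- decrease beats the quadratic error for small t'.
        · obtain ⟨c, hc, hev⟩ := hK.eventually_abs_cost_sub_le h hm hX
          have hev' : ∀ᶠ t' in 𝓝[>] (0 : ℝ), S.Stable (K - t' • G) ∧
              |pairing X₀ (S.value (K - t' • G)) - β + t' * frobSq G|
                ≤ c * (t' ^ 2 * frobSq G) := by
            have hl0 : Tendsto (fun t : ℝ => K - t • G) (𝓝[>] 0) (𝓝 K) := by
              have := hline.tendsto 0
              rw [zero_smul, sub_zero] at this
              exact this.mono_left nhdsWithin_le_nhds
            refine (hl0.eventually hev).mono fun t' ht' => ?_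
            rw [hlin, hfrob, sub_neg_eq_add] at ht'
            exact ht'
          have hsmall : ∀ᶠ t' in 𝓝[>] (0 : ℝ), t' < 1 / (c + 1) :=
            nhdsWithin_le_nhds (eventually_lt_nhds (by positivity))
          filter_upwards [hev', hsmall, self_mem_nhdsWithin] with t' h1 h2 (h3 : 0 < t')
          refine ⟨h1.1, ?_⟩
          have h4 := (abs_le.1 h1.2).2
          rw [lt_div_iff₀ (by positivity)] at h2
          have h5 : t' * c * (t' * frobSq G) ≤ 1 * (t' * frobSq G) :=
            mul_le_mul_of_nonneg_right (by nlinarith) (by positivity)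
          linarith
        -- For t > 0 the decrease already obtained is strict, so continuity suffices.
        · have hlt : pairing X₀ (S.value (K - t • G)) < β := by
            have := hdec t hts ht0 htη.le
            have : 0 < t / 2 * frobSq G := by positivity
            linarith
          have hl : Tendsto (fun t : ℝ => K - t • G) (𝓝[>] t) (𝓝 (K - t • G)) :=
            hline.continuousAt.mono_left nhdsWithin_le_nhds
          filter_upwards [hl.eventually (hts.1.eventually h), hl.eventually
            ((hts.1.continuousAt h hm hX).eventually_lt continuousAt_const hlt)] with t' h1 h2
          exact ⟨h1.1, h2.le⟩
      obtain ⟨t', ht', hmem⟩ := (hev.and (Ioc_mem_nhdsGT hy)).exists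
      exact ⟨t', ht', hmem⟩
  have hmem := hsub (Set.right_mem_Icc.2 hη.le)
  exact ⟨hmem.1, hdec η hmem hη.le le_rfl⟩

end MJLS

/-! ### The Markov property for functions of finite histories -/

section History

variable {N : ℕ} {W : Type*} [MeasurableSpace W]

/-- Extension of a history of modes up to time `t` to a sequence that is constant after `t`. -/
def extendHistory {t : ℕ} (σ : Fin (t + 1) → Fin N) : ℕ → Fin N := fun r =>
  σ ⟨min r t, by omega⟩

/-- A function of mode sequences that depends only on the modes up to time `t`. -/
def DependsOnHistory (t : ℕ) (f : (ℕ → Fin N) → ℝ) : Prop :=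
  ∀ s s' : ℕ → Fin N, (∀ r ≤ t, s r = s' r) → f s = f s'

omit [MeasurableSpace W] in
-- There are finitely many histories up to time t, so such a function is a finite combination of
-- cylinder indicators, and integrals reduce to cylinder probabilities.
theorem DependsOnHistory.eq_sum {t : ℕ} {f : (ℕ → Fin N) → ℝ} (hf : DependsOnHistory t f)
    (ω : ℕ → W → Fin N) (w : W) :
    f (fun r => ω r w) = ∑ σ : Fin (t + 1) → Fin N,
      {w | ∀ r ≤ t, ω r w = extendHistory σ r}.indicator (fun _ => f (extendHistory σ)) w := by
  classical
  rw [Finset.sum_eq_single (fun r : Fin (t + 1) => ω r w)]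
  · have hmem : w ∈ {w' | ∀ r ≤ t, ω r w' = extendHistory (fun r : Fin (t + 1) => ω r w) r} := by
      intro r hr
      simp [extendHistory, hr]
    rw [Set.indicator_of_mem hmem]
    exact hf _ _ hmem
  · intro σ _ hσ
    refine Set.indicator_of_notMem (fun hmem => hσ ?_) _
    funext r
    have := hmem r (by omega)
    rw [this, extendHistory]
    congr 1
    ext
    simp
    omega
  · simp

omit [MeasurableSpace W] in
theorem sum_indicator_mode (ω : ℕ → W → Fin N) (t : ℕ) (g : Fin N → W → ℝ) (w : W) :
    ∑ j, {w | ω t w = j}.indicator (g j) w = g (ω t w) w := by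
  classical
  simp [Set.indicator_apply]

theorem measurableSet_mode {ω : ℕ → W → Fin N} (hω : ∀ t, Measurable (ω t)) (t : ℕ) (j : Fin N) :
    MeasurableSet {w | ω t w = j} :=
  hω t (measurableSet_singleton j)

theorem measurableSet_history {ω : ℕ → W → Fin N} (hω : ∀ t, Measurable (ω t)) (t : ℕ)
    (s : ℕ → Fin N) : MeasurableSet {w | ∀ r ≤ t, ω r w = s r} := by
  have : {w | ∀ r ≤ t, ω r w = s r} = ⋂ r ∈ Finset.range (t + 1), {w | ω r w = s r} := by
    ext w; simp
  rw [this]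
  exact Finset.measurableSet_biInter _ fun r _ => measurableSet_mode hω r _

variable {ν : Measure W} [IsFiniteMeasure ν] {ω : ℕ → W → Fin N}

theorem DependsOnHistory.integrable {t : ℕ} {f : (ℕ → Fin N) → ℝ} (hf : DependsOnHistory t f)
    (hω : ∀ t, Measurable (ω t)) : Integrable (fun w => f fun r => ω r w) ν := by
  simp_rw [hf.eq_sum ω]
  exact integrable_finsetSum _ fun σ _ =>
    (integrable_const _).indicator (measurableSet_history hω t _)

theorem DependsOnHistory.setIntegral_eq {t : ℕ} {f : (ℕ → Fin N) → ℝ}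
    (hf : DependsOnHistory t f) (hω : ∀ t, Measurable (ω t)) (F : Set W) :
    ∫ w in F, f (fun r => ω r w) ∂ν = ∑ σ : Fin (t + 1) → Fin N,
      f (extendHistory σ) * ν.real ({w | ∀ r ≤ t, ω r w = extendHistory σ r} ∩ F) := by
  simp_rw [hf.eq_sum ω]
  rw [integral_finsetSum _ fun σ _ =>
    (integrable_const _).indicator (measurableSet_history hω t _)]
  refine Finset.sum_congr rfl fun σ _ => ?_
  have hm := measurableSet_history hω t (extendHistory σ)
  rw [integral_indicator_const _ hm, measureReal_restrict_apply hm, smul_eq_mul, mul_comm]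

/-- The Markov property for functions of the history. -/
theorem DependsOnHistory.setIntegral_succ {t : ℕ} {f : (ℕ → Fin N) → ℝ}
    (hf : DependsOnHistory t f) (hω : ∀ t, Measurable (ω t)) {p : Matrix (Fin N) (Fin N) ℝ}
    (hmarkov : ∀ (t : ℕ) (s : ℕ → Fin N) (j : Fin N),
      ν.real {w | (∀ r ≤ t, ω r w = s r) ∧ ω (t + 1) w = j}
        = p (s t) j * ν.real {w | ∀ r ≤ t, ω r w = s r}) (j : Fin N) :
    ∫ w in {w | ω (t + 1) w = j}, f (fun r => ω r w) ∂ν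
      = ∑ i, p i j * ∫ w in {w | ω t w = i}, f (fun r => ω r w) ∂ν := by
  simp_rw [hf.setIntegral_eq hω, Finset.mul_sum]
  rw [Finset.sum_comm]
  refine Finset.sum_congr rfl fun σ _ => ?_
  -- On the cylinder of σ the mode at time t is known, so only that i contributes.
  rw [Finset.sum_eq_single (extendHistory σ t)]
  · have e : {w | ∀ r ≤ t, ω r w = extendHistory σ r} ∩ {w | ω t w = extendHistory σ t}
        = {w | ∀ r ≤ t, ω r w = extendHistory σ r} :=
      Set.inter_eq_left.2 fun w hw => hw t le_rfl
    have e' : {w | ∀ r ≤ t, ω r w = extendHistory σ r} ∩ {w | ω (t + 1) w = j}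
        = {w | (∀ r ≤ t, ω r w = extendHistory σ r) ∧ ω (t + 1) w = j} := rfl
    rw [e, e', hmarkov]
    ring
  · intro i _ hi
    have e : {w | ∀ r ≤ t, ω r w = extendHistory σ r} ∩ {w | ω t w = i} = ∅ := by
      ext w
      simp only [Set.mem_inter_iff, Set.mem_ofPred_eq, Set.mem_empty_iff_false, iff_false, not_and]
      intro hw hw'
      exact hi (hw'.symm.trans (hw t le_rfl))
    simp [e]
  · simp

omit [IsFiniteMeasure ν] in
theorem integral_eq_sum_setIntegral_mode (hω : ∀ t, Measurable (ω t)) (t : ℕ) {g : W → ℝ}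
    (hg : Integrable g ν) : ∫ w, g w ∂ν = ∑ j, ∫ w in {w | ω t w = j}, g w ∂ν := by
  rw [← integral_iUnion_fintype (fun j => measurableSet_mode hω t j) ?_
    fun j => hg.integrableOn]
  · have : ⋃ j, {w | ω t w = j} = Set.univ := by ext w; simp
    rw [this, Measure.restrict_univ]
  · intro i j hij
    refine Set.disjoint_left.2 fun w hw hw' => hij ?_
    exact Eq.trans (Eq.symm hw) hw'

end History

/-! ### Second moments and stage costs of the closed loop -/

namespace MJLS

variable {N d k : ℕ} (S : MJLS N d k)

/-- The transition matrix of the closed loop along a mode sequence. -/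
def transition (K : MatTuple N k d) (s : ℕ → Fin N) : ℕ → Matrix (Fin d) (Fin d) ℝ
  | 0 => 1
  | t + 1 => S.closedLoop K (s t) * transition K s t

theorem state_eq_transition_mulVec (K : MatTuple N k d) (s : ℕ → Fin N) (v : Fin d → ℝ) (t : ℕ) :
    S.state K s v t = S.transition K s t *ᵥ v := by
  induction t with
  | zero => simp [state, transition]
  | succ t ih =>
    rw [state, transition, ← mulVec_mulVec, ← ih, closedLoop, sub_mulVec, mulVec_neg,
      ← sub_eq_add_neg, mulVec_mulVec]

theorem transition_congr (K : MatTuple N k d) {s s' : ℕ → Fin N} {t : ℕ}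
    (h : ∀ r < t, s r = s' r) : S.transition K s t = S.transition K s' t := by
  induction t with
  | zero => rfl
  | succ t ih =>
    rw [transition, transition, h t (Nat.lt_succ_self t), ih fun r hr => h r (by omega)]

theorem measurable_transition (K : MatTuple N k d) (t : ℕ) (a b : Fin d) :
    Measurable fun s : ℕ → Fin N => S.transition K s t a b := by
  induction t generalizing a b with
  | zero => exact measurable_const
  | succ t ih =>
    simp only [transition, mul_apply]
    refine Finset.measurable_sum _ fun c _ => Measurable.mul ?_ (ih c b)
    exact (measurable_of_countable fun i => S.closedLoop K i a c).comp (measurable_pi_apply t)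

theorem stageCost_eq (K : MatTuple N k d) (s : ℕ → Fin N) (v : Fin d → ℝ) (t : ℕ) :
    S.stageCost K s v t
      = S.state K s v t ⬝ᵥ (S.runningCost K (s t) *ᵥ S.state K s v t) := by
  rw [stageCost, control, runningCost, add_mulVec, dotProduct_add, mulVec_neg, neg_dotProduct,
    dotProduct_neg, neg_neg, ← mulVec_mulVec, ← mulVec_mulVec, dotProduct_mulVec _ (K (s t))ᵀ,
    vecMul_transpose]

section Moments

variable {W : Type*} [MeasurableSpace W]

omit [MeasurableSpace W] in
-- Separates the initial state from the modes, so that independence can factor the expectation.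
theorem indicator_state_mul_state (y : W → Fin d → ℝ) (ω : ℕ → W → Fin N) (K : MatTuple N k d) (t : ℕ) (a b : Fin d) (j : Fin N) (w : W) :
    {w | ω t w = j}.indicator (fun w => S.state K (fun r => ω r w) (y w) t a
        * S.state K (fun r => ω r w) (y w) t b) w
      = ∑ c, ∑ e, (y w c * y w e) * {w | ω t w = j}.indicator (fun w =>
        S.transition K (fun r => ω r w) t a c * S.transition K (fun r => ω r w) t b e) w := by
  by_cases hw : w ∈ {w | ω t w = j}
  · simp only [Set.indicator_of_mem hw, state_eq_transition_mulVec, mulVec, dotProduct,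
      Finset.sum_mul_sum]
    exact Finset.sum_congr rfl fun c _ => Finset.sum_congr rfl fun e _ => by ring
  · simp [Set.indicator_of_notMem hw]

/-- An initial state of finite second moments, independent of a Markovian mode process. -/
structure IsDriven (ν : Measure W) (y : W → Fin d → ℝ) (ω : ℕ → W → Fin N) : Prop where
  measurable_init : Measurable y
  memLp_init : MemLp y 2 ν
  measurable_mode : ∀ t, Measurable (ω t)
  markov : ∀ (t : ℕ) (s : ℕ → Fin N) (j : Fin N),
    ν.real {w | (∀ r ≤ t, ω r w = s r) ∧ ω (t + 1) w = j}
      = S.p (s t) j * ν.real {w | ∀ r ≤ t, ω r w = s r}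
  indep : IndepFun y (fun w t => ω t w) ν

variable {S} {ν : Measure W} [IsFiniteMeasure ν] {y : W → Fin d → ℝ} {ω : ℕ → W → Fin N}

omit [IsFiniteMeasure ν] in
theorem dependsOnHistory_transition (K : MatTuple N k d) (C₀ : Matrix (Fin d) (Fin d) ℝ)
    (t : ℕ) (a b : Fin d) : DependsOnHistory t fun s =>
      (S.transition K s t * C₀ * (S.transition K s t)ᵀ) a b := fun s s' hs => by
  simp only [S.transition_congr K fun r hr => hs r hr.le]

/-- Induction on time: the Markov property replaces the event at time t + 1 by those at time t, on
each of which the newest closed-loop factor is constant. -/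
theorem setIntegral_transition (hω : ∀ t, Measurable (ω t))
    (hmarkov : ∀ (t : ℕ) (s : ℕ → Fin N) (j : Fin N),
      ν.real {w | (∀ r ≤ t, ω r w = s r) ∧ ω (t + 1) w = j}
        = S.p (s t) j * ν.real {w | ∀ r ≤ t, ω r w = s r})
    (K : MatTuple N k d) (C₀ : Matrix (Fin d) (Fin d) ℝ) (t : ℕ) (j : Fin N) (a b : Fin d) :
    ∫ w in {w | ω t w = j}, (S.transition K (fun r => ω r w) t * C₀
        * (S.transition K (fun r => ω r w) t)ᵀ) a b ∂ν
      = (S.forward K ^ t) (fun i => ν.real {w | ω 0 w = i} • C₀) j a b := by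
  induction t generalizing j a b with
  | zero => simp [transition]
  | succ t ih =>
    have hdep : DependsOnHistory t fun s =>
        (S.transition K s (t + 1) * C₀ * (S.transition K s (t + 1))ᵀ) a b := fun s s' hs => by
      simp only [S.transition_congr K (t := t + 1) fun r hr => hs r (by omega)]
    rw [hdep.setIntegral_succ hω hmarkov, pow_succ', Module.End.mul_apply, forward_apply,
      Matrix.sum_apply]
    refine Finset.sum_congr rfl fun i _ => ?_
    rw [Matrix.smul_apply, smul_eq_mul]
    congr 1
    have hexp : ∀ Y : Matrix (Fin d) (Fin d) ℝ,
        (S.closedLoop K i * Y * (S.closedLoop K i)ᵀ) a b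
          = ∑ c, ∑ e, S.closedLoop K i a e * S.closedLoop K i b c * Y e c := fun Y => by
      simp only [mul_apply, transpose_apply, Finset.sum_mul]
      exact Finset.sum_congr rfl fun c _ => Finset.sum_congr rfl fun e _ => by ring
    have hint : ∀ e c, Integrable (fun w => (S.transition K (fun r => ω r w) t * C₀
        * (S.transition K (fun r => ω r w) t)ᵀ) e c) (ν.restrict {w | ω t w = i}) := fun e c =>
      ((dependsOnHistory_transition K C₀ t e c).integrable hω).integrableOn
    rw [hexp]
    simp_rw [← ih]
    calc _ = ∫ w in {w | ω t w = i}, ∑ c, ∑ e, S.closedLoop K i a e * S.closedLoop K i b c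
            * (S.transition K (fun r => ω r w) t * C₀
              * (S.transition K (fun r => ω r w) t)ᵀ) e c ∂ν := by
          refine setIntegral_congr_fun (measurableSet_mode hω t i) fun w hw => ?_
          have hw : ω t w = i := hw
          simp only [← hexp, transition, hw, transpose_mul, Matrix.mul_assoc]
      _ = _ := by
          rw [integral_finsetSum _ fun c _ => integrable_finsetSum _ fun e _ =>
            (hint e c).const_mul _]
          refine Finset.sum_congr rfl fun c _ => ?_
          rw [integral_finsetSum _ fun e _ => (hint e c).const_mul _]
          exact Finset.sum_congr rfl fun e _ => integral_const_mul _ _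

namespace IsDriven

variable (hD : S.IsDriven ν y ω)
include hD

omit [IsFiniteMeasure ν] in
theorem integrable_init_mul (c e : Fin d) : Integrable (fun w => y w c * y w e) ν :=
  (hD.memLp_init.eval c).integrable_mul (hD.memLp_init.eval e)

theorem integrable_transition_mul (K : MatTuple N k d) (t : ℕ) (a b c e : Fin d) (j : Fin N) :
    Integrable (fun w => ({w | ω t w = j}.indicator (fun w =>
      S.transition K (fun r => ω r w) t a c * S.transition K (fun r => ω r w) t b e) w)) ν := by
  have hdep : DependsOnHistory t fun s : ℕ → Fin N =>
      S.transition K s t a c * S.transition K s t b e := fun s s' hs => by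
    simp only [S.transition_congr K fun r hr => hs r hr.le]
  exact (hdep.integrable hD.measurable_mode).indicator (measurableSet_mode hD.measurable_mode t j)

omit [IsFiniteMeasure ν] in
theorem indepFun_mul_transition (K : MatTuple N k d) (t : ℕ) (a b c e : Fin d) (j : Fin N) :
    IndepFun (fun w => y w c * y w e) (fun w => {w | ω t w = j}.indicator (fun w =>
      S.transition K (fun r => ω r w) t a c * S.transition K (fun r => ω r w) t b e) w) ν := by
  have h1 : Measurable fun v : Fin d → ℝ => v c * v e := by fun_prop
  have h2 : Measurable ({s : ℕ → Fin N | s t = j}.indicator fun s =>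
      S.transition K s t a c * S.transition K s t b e) :=
    ((S.measurable_transition K t a c).mul (S.measurable_transition K t b e)).indicator
      ((measurable_pi_apply t : Measurable fun s : ℕ → Fin N => s t)
        (measurableSet_singleton j))
  exact hD.indep.comp h1 h2

theorem integrable_indicator_state_mul (K : MatTuple N k d) (t : ℕ) (a b : Fin d) (j : Fin N) :
    Integrable ({w | ω t w = j}.indicator fun w => S.state K (fun r => ω r w) (y w) t a
      * S.state K (fun r => ω r w) (y w) t b) ν := by
  refine (integrable_finsetSum _ fun c _ => integrable_finsetSum _ fun e _ => ?_).congr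
    (ae_of_all _ fun w => (S.indicator_state_mul_state y ω K t a b j w).symm)
  exact (hD.indepFun_mul_transition K t a b c e j).integrable_mul (hD.integrable_init_mul c e)
    (hD.integrable_transition_mul K t a b c e j)

theorem integrable_state_mul (K : MatTuple N k d) (t : ℕ) (a b : Fin d) :
    Integrable (fun w => S.state K (fun r => ω r w) (y w) t a
      * S.state K (fun r => ω r w) (y w) t b) ν := by
  refine (integrable_finsetSum Finset.univ fun j _ =>
    hD.integrable_indicator_state_mul K t a b j).congr (ae_of_all _ fun w => ?_)
  exact sum_indicator_mode ω t (fun _ w => S.state K (fun r => ω r w) (y w) t a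
    * S.state K (fun r => ω r w) (y w) t b) w

theorem secondMoment_restrict (K : MatTuple N k d) (t : ℕ) (j : Fin N) :
    secondMoment (ν.restrict {w | ω t w = j}) (fun w => S.state K (fun r => ω r w) (y w) t)
      = (S.forward K ^ t) (fun i => ν.real {w | ω 0 w = i} • secondMoment ν y) j := by
  ext a b
  have hm := measurableSet_mode hD.measurable_mode t j
  rw [← setIntegral_transition hD.measurable_mode hD.markov, secondMoment, of_apply,
    ← integral_indicator hm]
  have hprod : ∀ c e, Integrable (fun w => (y w c * y w e) * {w | ω t w = j}.indicator (fun w =>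
      S.transition K (fun r => ω r w) t a c * S.transition K (fun r => ω r w) t b e) w) ν :=
    fun c e => (hD.indepFun_mul_transition K t a b c e j).integrable_mul
      (hD.integrable_init_mul c e) (hD.integrable_transition_mul K t a b c e j)
  simp_rw [S.indicator_state_mul_state y ω K t a b j]
  rw [integral_finsetSum _ fun c _ => integrable_finsetSum _ fun e _ =>
    hprod c e]
  have hexp : ∀ w, (S.transition K (fun r => ω r w) t * secondMoment ν y
        * (S.transition K (fun r => ω r w) t)ᵀ) a b
      = ∑ c, ∑ e, secondMoment ν y c e
        * (S.transition K (fun r => ω r w) t a c * S.transition K (fun r => ω r w) t b e) :=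
    fun w => by
      simp only [mul_apply, transpose_apply, Finset.sum_mul]
      rw [Finset.sum_comm]
      exact Finset.sum_congr rfl fun c _ => Finset.sum_congr rfl fun e _ => by ring
  simp_rw [hexp]
  have hint : ∀ c e, Integrable (fun w => secondMoment ν y c e *
      (S.transition K (fun r => ω r w) t a c * S.transition K (fun r => ω r w) t b e))
      (ν.restrict {w | ω t w = j}) := fun c e =>
    ((integrable_indicator_iff hm).1 (hD.integrable_transition_mul K t a b c e j)).const_mul _
  rw [integral_finsetSum _ fun c _ => integrable_finsetSum _ fun e _ => hint c e]
  refine Finset.sum_congr rfl fun c _ => ?_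
  rw [integral_finsetSum _ fun e _ => hint c e, integral_finsetSum _ fun e _ => hprod c e]
  refine Finset.sum_congr rfl fun e _ => ?_
  rw [(hD.indepFun_mul_transition K t a b c e j).integral_fun_mul_eq_mul_integral
    (hD.integrable_init_mul c e).aestronglyMeasurable
    (hD.integrable_transition_mul K t a b c e j).aestronglyMeasurable, integral_const_mul,
    integral_indicator hm]
  rfl

theorem secondMoment_state (K : MatTuple N k d) (t : ℕ) :
    secondMoment ν (fun w => S.state K (fun r => ω r w) (y w) t)
      = ∑ j, (S.forward K ^ t) (fun i => ν.real {w | ω 0 w = i} • secondMoment ν y) j := by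
  ext a b
  simp_rw [← hD.secondMoment_restrict K t]
  rw [Matrix.sum_apply]
  exact integral_eq_sum_setIntegral_mode hD.measurable_mode t (hD.integrable_state_mul K t a b)

theorem integrable_stageCost (K : MatTuple N k d) (t : ℕ) :
    Integrable (fun w => S.stageCost K (fun r => ω r w) (y w) t) ν ∧
    ∫ w, S.stageCost K (fun r => ω r w) (y w) t ∂ν
      = pairing ((S.forward K ^ t) (fun i => ν.real {w | ω 0 w = i} • secondMoment ν y))
        (S.runningCost K) := by
  set x : W → Fin d → ℝ := fun w => S.state K (fun r => ω r w) (y w) t with hx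
  have hform : ∀ (Y : Matrix (Fin d) (Fin d) ℝ) (w : W), x w ⬝ᵥ (Y *ᵥ x w)
      = ∑ a, ∑ b, Y b a * (x w a * x w b) := fun Y w => by
    rw [Finset.sum_comm]
    simp only [dotProduct, mulVec, Finset.mul_sum]
    exact Finset.sum_congr rfl fun a _ => Finset.sum_congr rfl fun b _ => by ring
  have hint : ∀ Y : Matrix (Fin d) (Fin d) ℝ,
      Integrable (fun w => x w ⬝ᵥ (Y *ᵥ x w)) ν := fun Y => by
    simp_rw [hform]
    exact integrable_finsetSum _ fun a _ => integrable_finsetSum _ fun b _ =>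
      (hD.integrable_state_mul K t a b).const_mul _
  have hI : Integrable (fun w => S.stageCost K (fun r => ω r w) (y w) t) ν := by
    refine (integrable_finsetSum Finset.univ fun j _ => (hint (S.runningCost K j)).indicator
      (measurableSet_mode hD.measurable_mode t j)).congr (ae_of_all _ fun w => ?_)
    exact (sum_indicator_mode ω t (fun j w => x w ⬝ᵥ (S.runningCost K j *ᵥ x w)) w).trans
      (S.stageCost_eq K _ _ t).symm
  refine ⟨hI, ?_⟩
  rw [integral_eq_sum_setIntegral_mode hD.measurable_mode t hI, pairing_apply]
  refine Finset.sum_congr rfl fun j _ => ?_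
  rw [← hD.secondMoment_restrict K t j]
  calc _ = ∫ w in {w | ω t w = j}, ∑ a, ∑ b, S.runningCost K j b a * (x w a * x w b) ∂ν := by
        refine setIntegral_congr_fun (measurableSet_mode hD.measurable_mode t j) fun w hw => ?_
        have hw : ω t w = j := hw
        simp only [stageCost_eq, hw]
        exact hform _ w
    _ = _ := by
        have hi : ∀ a b, Integrable (fun w => x w a * x w b) (ν.restrict {w | ω t w = j}) :=
          fun a b => (hD.integrable_state_mul K t a b).integrableOn
        rw [integral_finsetSum _ fun a _ => integrable_finsetSum _ fun b _ =>
          (hi a b).const_mul _]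
        simp only [trace, diag_apply, mul_apply]
        refine Finset.sum_congr rfl fun a _ => ?_
        rw [integral_finsetSum _ fun b _ => (hi a b).const_mul _]
        refine Finset.sum_congr rfl fun b _ => ?_
        rw [integral_const_mul, mul_comm]
        rfl

end IsDriven

end Moments

end MJLS

/-! ### Rank-one pairings and contracting sequences -/

theorem pairing_single {N d : ℕ} (i : Fin N) (v : Fin d → ℝ) (Y : MatTuple N d d) :
    pairing (Pi.single i (vecMulVec v v)) Y = v ⬝ᵥ (Y i *ᵥ v) := by
  rw [pairing_apply, Finset.sum_eq_single i]
  · rw [Pi.single_eq_same, vecMulVec_mul, trace_vecMulVec, dotProduct_comm, ← dotProduct_mulVec]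
  · intro j _ hj
    simp [Pi.single_eq_of_ne hj]
  · simp

/-- No sign of ρ is assumed: either e 0 > 0 and nonnegativity of e 1 forces ρ ≥ 0, or the whole
sequence vanishes. -/
theorem le_pow_mul_of_le_mul {e : ℕ → ℝ} {ρ : ℝ} (he : ∀ n, 0 ≤ e n)
    (h : ∀ n, e (n + 1) ≤ ρ * e n) (n : ℕ) : e n ≤ ρ ^ n * e 0 := by
  rcases (he 0).eq_or_lt with h0 | h0
  · have hz : ∀ n, e n ≤ 0 := fun n => by
      induction n with
      | zero => exact h0.ge
      | succ n ih => simpa [le_antisymm ih (he n)] using h n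
    simpa [← h0] using hz n
  · have hρ : 0 ≤ ρ := nonneg_of_mul_nonneg_left ((he 1).trans (h 0)) h0
    induction n with
    | zero => simp
    | succ n ih =>
      calc e (n + 1) ≤ ρ * e n := h n
        _ ≤ ρ * (ρ ^ n * e 0) := mul_le_mul_of_nonneg_left ih hρ
        _ = _ := by ring

theorem tendsto_zero_of_le_mul {e : ℕ → ℝ} {ρ : ℝ} (hρ : ρ < 1) (he : ∀ n, 0 ≤ e n)
    (h : ∀ n, e (n + 1) ≤ ρ * e n) : Tendsto e atTop (𝓝 0) := by
  have hle : ∀ n, e (n + 1) ≤ max ρ 0 * e n := fun n =>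
    (h n).trans (mul_le_mul_of_nonneg_right (le_max_left _ _) (he n))
  refine squeeze_zero he (le_pow_mul_of_le_mul he hle) ?_
  simpa using (tendsto_pow_atTop_nhds_zero_of_lt_one (le_max_right ρ 0)
    (max_lt hρ one_pos)).mul_const (e 0)

theorem tendsto_of_frobSq_sub {N m n : ℕ} {K : ℕ → MatTuple N m n} {L : MatTuple N m n}
    (h : Tendsto (fun t => frobSq (K t - L)) atTop (𝓝 0)) : Tendsto K atTop (𝓝 L) := by
  refine tendsto_pi_nhds.2 fun i => tendsto_pi_nhds.2 fun a => tendsto_pi_nhds.2 fun b => ?_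
  rw [← tendsto_sub_nhds_zero_iff]
  have hs : Tendsto (fun t => √(frobSq (K t - L))) atTop (𝓝 0) := by
    simpa using h.sqrt
  exact squeeze_zero_norm (fun t => Real.abs_le_sqrt (sq_apply_le_frobSq (K t - L) i a b)) hs

/-! ### Stability, cost and gradient of the stochastic problem -/

namespace MJLS

variable {N d k : ℕ} {S : MJLS N d k}

theorem IsRiccatiSolution.eq_value (h : S.IsRegular) {P : MatTuple N d d}
    (hP : S.IsRiccatiSolution P) {Ks : MatTuple N k d} (hKs : S.Stable Ks)
    (h0 : S.gainResidual Ks (S.value Ks) = 0) : P = S.value Ks := by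
  obtain ⟨hst, hval, hres⟩ := hP.stable h
  have hres' : S.gainResidual (S.riccatiGain P) (S.value (S.riccatiGain P)) = 0 := by
    rw [← hval]; exact hres
  rw [hval]
  exact le_antisymm (value_optimal_le h hKs hst hres') (value_optimal_le h hst hKs h0)

/-- Stability follows if some power of `backward` maps the identity below half the identity. -/
theorem Stable.of_backward_pow_le (h : S.IsRegular) {K : MatTuple N k d} {t : ℕ}
    (ht : (S.backward K ^ t) 1 ≤ (2⁻¹ : ℝ) • 1) : S.Stable K := by
  refine Stable.of_le h (P := ∑ r ∈ Finset.range t, (S.backward K ^ r) 1)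
    (Finset.sum_nonneg fun r _ => h.backward_pow_nonneg K tuple_one_nonneg r)
    (by norm_num : (0 : ℝ) < 2⁻¹) le_rfl ?_
  -- Telescoping: the partial Neumann sum loses its first term 1 and gains the t-th power, at most
  -- 1/2, so it is a Lyapunov function for the weight 1/2.
  have e : S.backward K (∑ r ∈ Finset.range t, (S.backward K ^ r) 1)
      = ∑ r ∈ Finset.range t, (S.backward K ^ r) 1 + (S.backward K ^ t) 1 - 1 := by
    rw [eq_sub_iff_add_eq, ← Finset.sum_range_succ, Finset.sum_range_succ', map_sum]
    simp [pow_succ']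
  rw [e, ← sub_nonneg]
  rw [← sub_nonneg] at ht
  refine ht.trans (le_of_eq ?_)
  have e2 : (1 : MatTuple N d d) = (2⁻¹ : ℝ) • 1 + (2⁻¹ : ℝ) • 1 := by
    rw [← add_smul]; norm_num
  nth_rw 7 [e2]
  abel

section Realization

variable {W : Type*} [MeasurableSpace W] {Pr : Measure W} [IsProbabilityMeasure Pr]
  {x0 : W → Fin d → ℝ} {ω : ℕ → W → Fin N}

variable (S Pr x0) in
/-- The mode-wise second moments `π i • 𝔼[x₀ x₀ᵀ]` of the initial state. -/
def initialCov : MatTuple N d d := fun i => S.init i • secondMoment Pr x0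

omit [IsProbabilityMeasure Pr] in
theorem IsRealization.isDriven (hreal : S.IsRealization Pr x0 ω) : S.IsDriven Pr x0 ω where
  measurable_init := hreal.measurable_x0
  memLp_init := hreal.memLp_x0
  measurable_mode := hreal.measurable_mode
  markov := hreal.markov
  indep := hreal.indep

omit [IsProbabilityMeasure Pr] in
theorem IsRealization.initialCov_eq (hreal : S.IsRealization Pr x0 ω) :
    (fun i => Pr.real {w | ω 0 w = i} • secondMoment Pr x0) = S.initialCov Pr x0 := by
  ext1 i
  rw [hreal.init_law, initialCov]

theorem IsRealization.modeCov_eq (hreal : S.IsRealization Pr x0 ω) (K : MatTuple N k d) (t : ℕ) :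
    S.modeCov Pr x0 ω K t = (S.forward K ^ t) (S.initialCov Pr x0) := by
  ext1 i
  rw [modeCov, hreal.isDriven.secondMoment_restrict, hreal.initialCov_eq]

section Conditional

variable (hreal : S.IsRealization Pr x0 ω) (hpos : ∀ i, 0 < S.init i) (i : Fin N)
include hreal hpos

omit [IsProbabilityMeasure Pr] in
theorem IsRealization.measure_ne_zero : Pr {w | ω 0 w = i} ≠ 0 := by
  intro h0
  have := hreal.init_law i
  rw [measureReal_def, h0, ENNReal.toReal_zero] at this
  exact (hpos i).ne this

theorem IsRealization.isProbabilityMeasure_cond :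
    IsProbabilityMeasure (Pr[|{w | ω 0 w = i}]) :=
  cond_isProbabilityMeasure (hreal.measure_ne_zero hpos i)

/-- A cylinder either lies in the event ω(0) = i or misses it, so the Markov identity survives
conditioning; a constant initial state is independent of everything. -/
theorem IsRealization.isDriven_cond (v : Fin d → ℝ) :
    S.IsDriven (Pr[|{w | ω 0 w = i}]) (fun _ => v) ω := by
  have := hreal.isProbabilityMeasure_cond hpos i
  have hF := measurableSet_mode hreal.measurable_mode 0 i
  refine ⟨measurable_const, memLp_const v, hreal.measurable_mode, fun t s j => ?_,
    indepFun_const_left _ _⟩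
  simp only [measureReal_def, cond_apply hF, ENNReal.toReal_mul]
  by_cases hs : s 0 = i
  · have e1 : {w | ω 0 w = i} ∩ {w | (∀ r ≤ t, ω r w = s r) ∧ ω (t + 1) w = j}
        = {w | (∀ r ≤ t, ω r w = s r) ∧ ω (t + 1) w = j} :=
      Set.inter_eq_right.2 fun w hw => (hw.1 0 (Nat.zero_le t)).trans hs
    have e2 : {w | ω 0 w = i} ∩ {w | ∀ r ≤ t, ω r w = s r} = {w | ∀ r ≤ t, ω r w = s r} :=
      Set.inter_eq_right.2 fun w hw => (hw 0 (Nat.zero_le t)).trans hs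
    have hm := hreal.markov t s j
    simp only [measureReal_def] at hm
    rw [e1, e2, hm]
    ring
  · have e1 : {w | ω 0 w = i} ∩ {w | (∀ r ≤ t, ω r w = s r) ∧ ω (t + 1) w = j} = ∅ :=
      Set.eq_empty_of_forall_notMem fun w hw =>
        hs ((hw.2.1 0 (Nat.zero_le t)).symm.trans hw.1)
    have e2 : {w | ω 0 w = i} ∩ {w | ∀ r ≤ t, ω r w = s r} = ∅ :=
      Set.eq_empty_of_forall_notMem fun w hw => hs ((hw.2 0 (Nat.zero_le t)).symm.trans hw.1)
    simp [e1, e2]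

theorem IsRealization.secondMoment_cond (v : Fin d → ℝ) (K : MatTuple N k d) (t : ℕ) :
    secondMoment (Pr[|{w | ω 0 w = i}]) (fun w => S.state K (fun r => ω r w) v t)
      = ∑ j, (S.forward K ^ t) (Pi.single i (vecMulVec v v)) j := by
  have := hreal.isProbabilityMeasure_cond hpos i
  have hF := measurableSet_mode hreal.measurable_mode 0 i
  rw [(hreal.isDriven_cond hpos i v).secondMoment_state]
  have e : (fun i' => (Pr[|{w | ω 0 w = i}]).real {w | ω 0 w = i'}
      • secondMoment (Pr[|{w | ω 0 w = i}]) fun _ => v) = Pi.single i (vecMulVec v v) := by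
    have hsm : secondMoment (Pr[|{w | ω 0 w = i}]) (fun _ => v) = vecMulVec v v := by
      ext a b
      simp [secondMoment, vecMulVec_apply]
    rw [hsm]
    ext1 i'
    by_cases hi : i' = i
    · subst hi
      rw [Pi.single_eq_same, measureReal_def, cond_apply_self (hreal.measure_ne_zero hpos i')
        (measure_ne_top _ _), ENNReal.toReal_one, one_smul]
    · rw [Pi.single_eq_of_ne hi, measureReal_def, cond_apply hF]
      have : {w | ω 0 w = i} ∩ {w | ω 0 w = i'} = ∅ :=
        Set.eq_empty_of_forall_notMem fun w hw => hi (hw.2.symm.trans hw.1)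
      simp [this]
  rw [e]

omit i in
/-- Mean-square stability is the existence of a quadratic Lyapunov function. -/
theorem IsRealization.mem_stabilizing_iff (h : S.IsRegular) {K : MatTuple N k d} :
    K ∈ S.stabilizing Pr ω ↔ S.Stable K := by
  constructor
  · intro hK
    -- For initial state e_a and mode i, the trace of the second moment is, by duality, the a-th
    -- diagonal entry of the i-th member of the backward iterate of 1. All traces thus tend to 0.
    have hdiag : ∀ i a, Tendsto (fun t => (S.backward K ^ t) 1 i a a) atTop (𝓝 0) :=
      fun i a => by
        have h1 := hK (Pi.single a 1) i
        simp_rw [hreal.secondMoment_cond hpos i] at h1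
        have hc : Continuous (Matrix.trace : Matrix (Fin d) (Fin d) ℝ → ℝ) := by fun_prop
        have h2 := (hc.tendsto 0).comp h1
        rw [trace_zero] at h2
        refine h2.congr fun t => ?_
        rw [Function.comp_apply, trace_sum, ← pairing_one, pairing_forward_pow, pairing_single]
        simp
    have htr : Tendsto (fun t => pairing ((S.backward K ^ t) 1) 1) atTop (𝓝 0) := by
      simp only [pairing_one, trace, diag_apply]
      simpa using tendsto_finsetSum Finset.univ fun i _ =>
        tendsto_finsetSum Finset.univ fun a _ => hdiag i a
    obtain ⟨t, ht⟩ := (htr.eventually_lt_const (by norm_num : (0 : ℝ) < 2⁻¹)).exists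
    exact Stable.of_backward_pow_le h
      ((le_pairing_one_smul_one (h.backward_pow_nonneg K tuple_one_nonneg t)).trans
        (smul_le_smul_of_nonneg_right ht.le tuple_one_nonneg))
  · intro hK v i
    simp_rw [hreal.secondMoment_cond hpos i]
    have hnn : 0 ≤ (Pi.single i (vecMulVec v v) : MatTuple N d d) := by
      refine Pi.single_nonneg.2 ?_
      simpa using (posSemidef_vecMulVec_self_star v).nonneg
    have h0 := (hK.summable_forward h hnn).tendsto_atTop_zero
    have := tendsto_finsetSum Finset.univ fun j _ => tendsto_pi_nhds.1 h0 j
    simpa using this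

end Conditional

/-- Tonelli exchanges expectation and sum, and duality rewrites each expected stage cost as X₀
paired with a term of the Neumann series. -/
theorem IsRealization.extCost_eq (hreal : S.IsRealization Pr x0 ω) (h : S.IsRegular)
    (hX : 0 ≤ S.initialCov Pr x0) {K : MatTuple N k d} (hK : S.Stable K) :
    S.extCost Pr x0 ω K = ENNReal.ofReal (pairing (S.initialCov Pr x0) (S.value K)) := by
  have hsc := fun t => hreal.isDriven.integrable_stageCost K t
  rw [hreal.initialCov_eq] at hsc
  have hrc := h.runningCost_nonneg K
  have hnn : ∀ t w, 0 ≤ S.stageCost K (fun r => ω r w) (x0 w) t := fun t w => by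
    rw [stageCost_eq]
    exact (nonneg_iff_dotProduct_mulVec.1 (hrc _)).2 _
  rw [extCost, lintegral_tsum fun t => (hsc t).1.aemeasurable.ennreal_ofReal]
  have e : ∀ t, ∫⁻ w, ENNReal.ofReal (S.stageCost K (fun r => ω r w) (x0 w) t) ∂Pr
      = ENNReal.ofReal (pairing (S.initialCov Pr x0) ((S.backward K ^ t) (S.runningCost K))) :=
    fun t => by
      rw [← ofReal_integral_eq_lintegral_ofReal (hsc t).1 (ae_of_all _ (hnn t)), (hsc t).2,
        pairing_forward_pow]
  simp_rw [e]
  have hs := (hK.summable_backward h hrc).hasSum.map (pairing (S.initialCov Pr x0))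
    (pairing_right_continuous _)
  rw [← ENNReal.ofReal_tsum_of_nonneg
    (fun t => pairing_nonneg hX (h.backward_pow_nonneg K hrc t)) hs.summable]
  exact congrArg _ hs.tsum_eq

theorem IsRealization.cost_eq (hreal : S.IsRealization Pr x0 ω) (h : S.IsRegular)
    (hX : 0 ≤ S.initialCov Pr x0) {K : MatTuple N k d} (hK : S.Stable K) :
    S.cost Pr x0 ω K = pairing (S.initialCov Pr x0) (S.value K) := by
  rw [cost, hreal.extCost_eq h hX hK,
    ENNReal.toReal_ofReal (pairing_nonneg hX (Stable.value_nonneg h K))]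

theorem IsRealization.hasFDerivAt_cost (hreal : S.IsRealization Pr x0 ω) (h : S.IsRegular)
    {m : ℝ} (hm : 0 < m) (hX : m • 1 ≤ S.initialCov Pr x0) {K : MatTuple N k d}
    (hK : S.Stable K) :
    HasFDerivAt (S.cost Pr x0 ω)
      (frobInner (S.costGradient (S.initialCov Pr x0) K)).toContinuousLinearMap K :=
  (hK.hasFDerivAt h hm hX).congr_of_eventuallyEq
    ((hK.eventually h).mono fun _ hK' => hreal.cost_eq h (initial_nonneg hm hX) hK'.1)

theorem IsRealization.gradCost_eq (hreal : S.IsRealization Pr x0 ω) (h : S.IsRegular)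
    {m : ℝ} (hm : 0 < m) (hX : m • 1 ≤ S.initialCov Pr x0) {K : MatTuple N k d}
    (hK : S.Stable K) :
    S.gradCost Pr x0 ω K = S.costGradient (S.initialCov Pr x0) K := by
  ext i a b
  rw [gradCost, of_apply, (hreal.hasFDerivAt_cost h hm hX hK).fderiv]
  exact frobInner_single _ i a b

omit [IsProbabilityMeasure Pr] in
theorem mu_smul_one_le_initialCov (hpos : ∀ i, 0 < S.init i)
    (hcov : (secondMoment Pr x0).PosDef) :
    S.mu Pr x0 • (1 : MatTuple N d d) ≤ S.initialCov Pr x0 := fun i => by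
  have h1 := smul_le_smul_of_nonneg_left (sigmaMin_smul_one_le hcov) (hpos i).le
  refine le_trans ?_ h1
  rw [smul_smul]
  exact smul_le_smul_of_nonneg_right (mul_le_mul_of_nonneg_right
    (ciInf_le (Set.finite_range _).bddBelow i) (sigmaMin_nonneg _)) PosSemidef.one.nonneg

omit [IsProbabilityMeasure Pr] in
theorem mu_pos [Nonempty (Fin N)] (hd : 0 < d) (hpos : ∀ i, 0 < S.init i)
    (hcov : (secondMoment Pr x0).PosDef) : 0 < S.mu Pr x0 :=
  mul_pos (ciInf_pos_of_forall_pos hpos) (sigmaMin_pos hd hcov)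

omit [IsProbabilityMeasure Pr] in
theorem exists_smul_one_le_initialCov [Nonempty (Fin N)] (hpos : ∀ i, 0 < S.init i)
    (hcov : (secondMoment Pr x0).PosDef) :
    ∃ m : ℝ, 0 < m ∧ m • (1 : MatTuple N d d) ≤ S.initialCov Pr x0 :=
  exists_pos_smul_one_le fun i => hcov.smul (hpos i)

omit [IsProbabilityMeasure Pr] in
-- In these degenerate dimensions 1/L is 0 by convention, so no positive step size is admissible.
theorem smoothConst_eq_zero [Nonempty (Fin N)] (hdk : d = 0 ∨ k = 0) (α : ℝ) :
    S.smoothConst Pr x0 α = 0 := by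
  rcases hdk with rfl | rfl
  · have : lambdaMin S.Q = 0 := by simp [lambdaMin, sigmaMin_of_size_zero]
    simp [smoothConst, this]
  · have h1 : maxNorm S.R = 0 := by simp [maxNorm, specNorm_of_size_zero]
    have h2 : maxNorm S.B = 0 := by simp [maxNorm, specNorm_of_size_zero]
    simp [smoothConst, h1, h2]

/-! ### Convergence of gradient descent -/

/-- Global linear convergence of gradient descent to a stationary stabilizing gain. -/
theorem IsRealization.gradientDescent_convergence (hreal : S.IsRealization Pr x0 ω)
    (h : S.IsRegular) (hpos : ∀ i, 0 < S.init i) (hcov : (secondMoment Pr x0).PosDef)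
    {Ks : MatTuple N k d} (hKs : S.Stable Ks) (h0 : S.gainResidual Ks (S.value Ks) = 0)
    {K0 : MatTuple N k d} (hK0 : S.Stable K0) {η : ℝ} (hη : 0 < η)
    (hηL : η ≤ 1 / S.smoothConst Pr x0 (S.cost Pr x0 ω K0)) :
    (∀ n, S.Stable (S.gdIter Pr x0 ω η K0 n)) ∧
    (∀ n, S.cost Pr x0 ω (S.gdIter Pr x0 ω η K0 n) - S.cost Pr x0 ω Ks
      ≤ (1 - 2 * S.mu Pr x0 ^ 2 * lambdaMin S.R / maxNorm (S.sumCov Pr x0 ω Ks) * η) ^ n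
        * (S.cost Pr x0 ω K0 - S.cost Pr x0 ω Ks)) ∧
    Tendsto (S.gdIter Pr x0 ω η K0) atTop (𝓝 Ks) := by
  have := h.nonempty
  have hLpos : 0 < S.smoothConst Pr x0 (S.cost Pr x0 ω K0) :=
    one_div_pos.1 (hη.trans_le hηL)
  have hd : 0 < d := Nat.pos_of_ne_zero fun hd =>
    hLpos.ne' (smoothConst_eq_zero (Or.inl hd) _)
  have hk : 0 < k := Nat.pos_of_ne_zero fun hk =>
    hLpos.ne' (smoothConst_eq_zero (Or.inr hk) _)
  have hηL' : η * S.smoothConst Pr x0 (S.cost Pr x0 ω K0) ≤ 1 := by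
    rwa [le_div_iff₀ hLpos] at hηL
  have hm := S.mu_pos hd hpos hcov
  have hX := S.mu_smul_one_le_initialCov hpos hcov
  have hX0 := initial_nonneg hm hX
  have hsum : S.sumCov Pr x0 ω Ks = S.totalCov (S.initialCov Pr x0) Ks := by
    simp only [sumCov, totalCov, hreal.modeCov_eq]
  have hcost := fun {K : MatTuple N k d} (hK : S.Stable K) => hreal.cost_eq h hX0 hK
  have hgrad := fun {K : MatTuple N k d} (hK : S.Stable K) => hreal.gradCost_eq h hm hX hK
  rw [hcost hK0] at hηL'
  simp only [smoothConst] at hηL'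
  have hξ_def : ∀ α, S.xi Pr x0 α = 1 / lambdaMin S.Q
      * ((1 + maxNorm S.B ^ 2) / S.mu Pr x0 * α + maxNorm S.R) - 1 := fun _ => rfl
  have hq := lambdaMin_pos hd h.posDef_Q
  have hqQ : lambdaMin S.Q • 1 ≤ S.Q := lambdaMin_smul_one_le h.posDef_Q
  have hr := lambdaMin_pos hk h.posDef_R
  have hrR : lambdaMin S.R • 1 ≤ S.R := lambdaMin_smul_one_le h.posDef_R
  have hρ : S.R ≤ maxNorm S.R • 1 := le_maxNorm_smul_one fun i =>
    transpose_eq_of_nonneg (h.R_nonneg i)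
  have hB := transpose_mul_self_le_maxNorm S.B
  have hρ0 := maxNorm_nonneg S.R
  have hb := maxNorm_nonneg S.B
  have hcovs := Stable.totalCov_nonneg h hX0 Ks
  have hχ : S.totalCov (S.initialCov Pr x0) Ks ≤ maxNorm (S.sumCov Pr x0 ω Ks) • 1 := by
    rw [hsum]
    exact le_maxNorm_smul_one fun i => transpose_eq_of_nonneg (hcovs i)
  have hone : ∀ {c c' : ℝ}, c • (1 : MatTuple N d d) ≤ c' • 1 → c ≤ c' := fun {c c'} hc => by
    obtain ⟨i⟩ := h.nonempty
    have := dotProduct_mulVec_mono (hc i) (Pi.single ⟨0, hd⟩ 1)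
    simpa [smul_mulVec] using this
  have hχ0 : 0 < maxNorm (S.sumCov Pr x0 ω Ks) :=
    hm.trans_le (hone ((hKs.smul_one_le_totalCov h hm hX).trans hχ))
  set X₀ := S.initialCov Pr x0 with hX₀
  set m := S.mu Pr x0
  set q := lambdaMin S.Q
  set r := lambdaMin S.R
  set ρ := maxNorm S.R
  set b := maxNorm S.B
  set χ := maxNorm (S.sumCov Pr x0 ω Ks)
  set α := pairing X₀ (S.value K0) with hα
  -- From Q ≤ P^{K⁰} ≤ α/m; this is what makes ξ nonnegative.
  have hqα : q ≤ α / m := hone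
    (hqQ.trans ((hK0.Q_le_value h).trans (Stable.value_le_smul_one h hm hX le_rfl)))
  have hξq : q * S.xi Pr x0 α = α / m - q + (ρ + b ^ 2 * (α / m)) := by
    rw [hξ_def]
    field_simp
    ring
  have hξ : 0 ≤ S.xi Pr x0 α := by
    refine nonneg_of_mul_nonneg_right (a := q) ?_ hq
    rw [hξq]
    have : 0 ≤ b ^ 2 * (α / m) := mul_nonneg (sq_nonneg b) (hq.le.trans hqα)
    linarith
  have hstep : ∀ n, S.Stable (S.gdIter Pr x0 ω η K0 n) ∧
      pairing X₀ (S.value (S.gdIter Pr x0 ω η K0 n)) ≤ α ∧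
      S.Stable (S.gdIter Pr x0 ω η K0 (n + 1)) ∧
      pairing X₀ (S.value (S.gdIter Pr x0 ω η K0 (n + 1)))
        ≤ pairing X₀ (S.value (S.gdIter Pr x0 ω η K0 n))
          - η / 2 * frobSq (S.costGradient X₀ (S.gdIter Pr x0 ω η K0 n)) := by
    -- The cost never increases, so the initial level α and its constant L serve at every iterate.
    have hnext : ∀ n, S.Stable (S.gdIter Pr x0 ω η K0 n) →
        pairing X₀ (S.value (S.gdIter Pr x0 ω η K0 n)) ≤ α →
        S.Stable (S.gdIter Pr x0 ω η K0 (n + 1)) ∧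
        pairing X₀ (S.value (S.gdIter Pr x0 ω η K0 (n + 1)))
          ≤ pairing X₀ (S.value (S.gdIter Pr x0 ω η K0 n))
            - η / 2 * frobSq (S.costGradient X₀ (S.gdIter Pr x0 ω η K0 n)) := fun n hn hn' => by
      rw [gdIter, hgrad hn]
      exact hn.descent h hm hX hq hqQ hρ hρ0 hb hB hξ hξq hn' hη hηL'
    intro n
    induction n with
    | zero => exact ⟨hK0, le_rfl, hnext 0 hK0 le_rfl⟩
    | succ n ih =>
      have hle : pairing X₀ (S.value (S.gdIter Pr x0 ω η K0 (n + 1))) ≤ α := by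
        have := mul_nonneg (half_pos hη).le
          (frobSq_nonneg (S.costGradient X₀ (S.gdIter Pr x0 ω η K0 n)))
        linarith [ih.2.1, ih.2.2.2]
      exact ⟨ih.2.2.1, hle, hnext (n + 1) ih.2.2.1 hle⟩
  set e : ℕ → ℝ := fun n =>
    pairing X₀ (S.value (S.gdIter Pr x0 ω η K0 n)) - pairing X₀ (S.value Ks) with he
  have he0 : ∀ n, m * r * frobSq (S.gdIter Pr x0 ω η K0 n - Ks) ≤ e n := fun n =>
    frobSq_sub_optimal_le h hm hX (hstep n).1 hKs h0 hr.le hrR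
  have henn : ∀ n, 0 ≤ e n := fun n =>
    (mul_nonneg (mul_pos hm hr).le (frobSq_nonneg _)).trans (he0 n)
  have hcontr : ∀ n, e (n + 1) ≤ (1 - 2 * m ^ 2 * r / χ * η) * e n := fun n => by
    have h1 := (hstep n).2.2.2
    have h2 := (hstep n).1.cost_sub_le_frobSq_costGradient h hm hX hKs hr hrR hχ hχ0.le
    set g := frobSq (S.costGradient X₀ (S.gdIter Pr x0 ω η K0 n))
    have h3 : 4 * m ^ 2 * r * e n / χ ≤ g := by
      rw [div_le_iff₀ hχ0, mul_comm g]
      exact h2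
    have h4 := mul_le_mul_of_nonneg_left h3 (half_pos hη).le
    -- The rate: the factor η/2 of the descent step times the dominance constant 4m²r/χ.
    have h5 : η / 2 * (4 * m ^ 2 * r * e n / χ) = 2 * m ^ 2 * r / χ * η * e n := by ring
    have h6 : e (n + 1) ≤ e n - η / 2 * g := by simp only [he]; linarith
    linarith
  refine ⟨fun n => (hstep n).1, fun n => ?_, ?_⟩
  · rw [hcost (hstep n).1, hcost hKs, hcost hK0]
    exact le_pow_mul_of_le_mul henn hcontr n
  · have hlt : 1 - 2 * m ^ 2 * r / χ * η < 1 := by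
      have : 0 < 2 * m ^ 2 * r / χ * η := by positivity
      linarith
    have hlim := tendsto_zero_of_le_mul hlt henn hcontr
    refine tendsto_of_frobSq_sub (squeeze_zero (fun n => frobSq_nonneg _)
      (g := fun n => e n / (m * r)) (fun n => ?_) ?_)
    · rw [le_div_iff₀ (mul_pos hm hr), mul_comm]
      exact he0 n
    · simpa using hlim.div_const (m * r)

end Realization

end MJLS

end

theorem mainTheorem1 {N d k : ℕ} (S : MJLS N d k)
    {W : Type*} [MeasurableSpace W] (Pr : Measure W) [IsProbabilityMeasure Pr]
    (x0 : W → Fin d → ℝ) (ω : ℕ → W → Fin N)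
    (hp_nonneg : ∀ i j, 0 ≤ S.p i j) (hp_sum : ∀ i, ∑ j, S.p i j = 1)
    (hinit_pos : ∀ i, 0 < S.init i) (hinit_sum : ∑ i, S.init i = 1)
    (hreal : S.IsRealization Pr x0 ω)
    (hcov : (secondMoment Pr x0).PosDef)
    (hQ : ∀ i, (S.Q i).PosDef) (hR : ∀ i, (S.R i).PosDef)
    (hstab : (S.stabilizing Pr ω).Nonempty) :
    ∃ (P : MatTuple N d d) (Kstar : MatTuple N k d),
      -- `Kstar` is the gain of the unique positive definite Riccati solution
      S.IsRiccatiSolution P ∧ (∀ P', S.IsRiccatiSolution P' → P' = P) ∧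
      Kstar = S.riccatiGain P ∧
      -- it is stabilizing, a global minimizer, and the series defining `𝐗^{Kstar}` converges
      Kstar ∈ S.stabilizing Pr ω ∧
      S.extCost Pr x0 ω Kstar ≠ ∞ ∧
      (∀ K ∈ S.stabilizing Pr ω, S.extCost Pr x0 ω Kstar ≤ S.extCost Pr x0 ω K) ∧
      Summable (fun t => S.modeCov Pr x0 ω Kstar t) ∧
      ∀ K0 ∈ S.stabilizing Pr ω, ∀ η : ℝ, 0 < η →
        η ≤ 1 / S.smoothConst Pr x0 (S.cost Pr x0 ω K0) →
        -- the iterates stay in `𝕂`, where the cost is finite and differentiable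
        (∀ n, S.gdIter Pr x0 ω η K0 n ∈ S.stabilizing Pr ω ∧
          S.extCost Pr x0 ω (S.gdIter Pr x0 ω η K0 n) ≠ ∞ ∧
          DifferentiableAt ℝ (S.cost Pr x0 ω) (S.gdIter Pr x0 ω η K0 n)) ∧
        -- linear convergence to the global minimum
        (∀ n, S.cost Pr x0 ω (S.gdIter Pr x0 ω η K0 n) - S.cost Pr x0 ω Kstar
          ≤ (1 - 2 * S.mu Pr x0 ^ 2 * lambdaMin S.R
                / maxNorm (S.sumCov Pr x0 ω Kstar) * η) ^ n
            * (S.cost Pr x0 ω K0 - S.cost Pr x0 ω Kstar)) ∧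
        Tendsto (S.gdIter Pr x0 ω η K0) atTop (𝓝 Kstar) := by
  have hne : Nonempty (Fin N) := by
    by_contra hN
    rw [not_nonempty_iff] at hN
    simp at hinit_sum
  have h : S.IsRegular := ⟨hne, hp_nonneg, hp_sum, hQ, hR⟩
  have hst := fun {K : MatTuple N k d} => hreal.mem_stabilizing_iff hinit_pos h (K := K)
  -- `mu` would be 0 for d = 0, whereas the Riccati part is claimed in every dimension; hence some
  -- other positive lower bound of X₀.
  obtain ⟨m, hm, hX⟩ := S.exists_smul_one_le_initialCov hinit_pos hcov
  have hX0 := MJLS.initial_nonneg hm hX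
  have hext := fun {K : MatTuple N k d} (hK : S.Stable K) => hreal.extCost_eq h hX0 hK
  obtain ⟨Ks, hKs, h0⟩ := MJLS.exists_stable_gainResidual_eq_zero h hm hX (hstab.imp fun K hK => hst.1 hK)
  obtain ⟨hric, hgain⟩ := hKs.isRiccatiSolution h h0
  refine ⟨S.value Ks, Ks, hric, fun P' hP' => ?_, hgain, hst.2 hKs, ?_, fun K hK => ?_, ?_,
    fun K0 hK0 η hη hηL => ?_⟩
  · exact hP'.eq_value h hKs h0
  · rw [hext hKs]
    exact ENNReal.ofReal_ne_top
  · have hK' := hst.1 hK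
    rw [hext hKs, hext hK']
    exact ENNReal.ofReal_le_ofReal
      (pairing_mono_right hX0 (MJLS.value_optimal_le h hK' hKs h0))
  · simp only [hreal.modeCov_eq]
    exact hKs.summable_forward h hX0
  · obtain ⟨hstable, hrate, hlim⟩ :=
      hreal.gradientDescent_convergence h hinit_pos hcov hKs h0 (hst.1 hK0) hη hηL
    refine ⟨fun n => ⟨hst.2 (hstable n), ?_, ?_⟩, hrate, hlim⟩
    · rw [hext (hstable n)]
      exact ENNReal.ofReal_ne_top
    · exact (hreal.hasFDerivAt_cost h hm hX (hstable n)).differentiableAt
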